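/- **Setting.** All Banach spaces are complex. Let $A$ generate a strongly continuous semigroup $\mathbb T=(\mathbb T(t))_{t\ge 0}$ on a Banach space $X$, with growth bound $\omega(\mathbb T)=\inf\{\omega\in\mathbb R:\sup_{t>0}e^{-t\omega}\|\mathbb T(t)\|<\infty\}$, and put $\mathbb C_{\omega(\mathbb T)}=\{z\in\mathbb C:\operatorname{Re}z>\omega(\mathbb T)\}$. For $\beta\in\rho(A)$ let $X_1$ be $\mathrm D(A)$ with the norm $\|(\beta-A)x\|$, and let $X_{-1}$ be the completion of $X$ in the norm $\|(\beta-A)^{-1}x\|$; $\mathbb T$, $A$ and the resolvent $R(\alpha,A)$ extend continuously to $\mathbb T_{-1}(t):X_{-1}\to X_{-1}$, $A_{-1}:X\to X_{-1}$ and $R(\alpha,A):X_{-1}\to X$. A *system node* $\Sigma(A,B,C,\mathbf G)$ on Banach spaces $(U,X,Y)$ consists of such an $A$, operators $B\in\mathcal L(U,X_{-1})$, $C\in\mathcal L(X_1,Y)$, and an analytic function $\mathbf G:\mathbb C_{\omega(\mathbb T)}\to\mathcal L(U,Y)$ with $\mathbf G(\alpha)-\mathbf G(\alpha')=C[R(\alpha,A)-R(\alpha',A)]B$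 for all $\alpha,\alpha'\in\mathbb C_{\omega(\mathbb T)}$. Put $C\&D\begin{bmatrix}x\\u\end{bmatrix}=C[x-R(\gamma,A)Bu]+\mathbf G(\gamma)u$ (for any $\gamma\in\mathbb C_{\omega(\mathbb T)}$) on the domain $\{(x,u)\in X\times U: A_{-1}x+Bu\in X\}$. A *classical solution* is a triple $(u,x,y)$ with $u\in C([0,\infty),U)$, $x\in C^1([0,\infty),X)$, $y\in C([0,\infty),Y)$ such that for all $t\ge0$: $(x(t),u(t))$ lies in the domain of $C\&D$, $\dot x(t)=A_{-1}x(t)+Bu(t)$ and $y(t)=C\&D\begin{bmatrix}x(t)\\u(t)\end{bmatrix}$. The node is *$C^\infty$-BIBO stable* if there is $c>0$ such that for every classical solution with $x(0)=0$ and $u\in C_c^\infty((0,\infty),U)$ the output $y$ is bounded and $\sup_{t\ge0}\|y(t)\|\le c\sup_{t\ge0}\|u(t)\|$. The semigroup is *analytic* if, for some $\theta\in(0,\pi/2)$, it extends analytically to the open sector $\{z\ne0:|\arg z|<\theta\}$ and the extension has the semigroup property there. **Proposition.** Let $\Sigma(A,B,C,\mathbf G)$ be a $C^\infty$-BIBO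 stable system node such that $A$ generates an analytic semigroup and the input and output spaces $U$ and $Y$ are finite-dimensional. Then $\mathbb T_{-1}(t)B\in\mathcal L(U,X_1)$ for every $t>0$, and the function $t\mapsto C\,\mathbb T_{-1}(t)B$ belongs to $L^1([0,\infty);\mathcal L(U,Y))$. -/

import Mathlib

open Filter Topology Set MeasureTheory
open scoped NNReal ContDiff

/-- A strongly continuous semigroup of bounded operators on a complex normed space. -/
structure C0Semigroup (X : Type*) [NormedAddCommGroup X] [NormedSpace ℂ X] where
  /-- the operator `T(t)`, `t ≥ 0` -/
  op : ℝ≥0 → X →L[ℂ] X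
  op_zero : op 0 = ContinuousLinearMap.id ℂ X
  op_add : ∀ s t, op (s + t) = (op s).comp (op t)
  continuous_orbit : ∀ x, Continuous fun t => op t x

namespace C0Semigroup

section Generator

variable {X : Type*} [NormedAddCommGroup X] [NormedSpace ℂ X] (T : C0Semigroup X)

/-- The graph of the generator: all `(x, y)` with `(T(h)x - x)/h → y` as `h ↓ 0`. -/
def generatorGraph : Submodule ℂ (X × X) where
  carrier := {p | Tendsto (fun h : ℝ≥0 => (h : ℂ)⁻¹ • (T.op h p.1 - p.1)) (𝓝[>] 0) (𝓝 p.2)}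
  zero_mem' := by simp
  add_mem' := by
    intro p q hp hq
    refine (Tendsto.add hp hq).congr fun h => ?_
    simp only [Prod.fst_add, map_add]
    module
  smul_mem' := by
    intro c p hp
    refine (Tendsto.const_smul hp c).congr fun h => ?_
    simp only [Prod.smul_fst, map_smul]
    module

/-- The generator `A : D(A) ⊆ X → X` of the semigroup. -/
noncomputable def generator : X →ₗ.[ℂ] X := T.generatorGraph.toLinearPMap

theorem generatorGraph_single_valued (p : X × X) (hp : p ∈ T.generatorGraph) (h0 : p.1 = 0) :
    p.2 = 0 := by
  have h : Tendsto (fun h : ℝ≥0 => (h : ℂ)⁻¹ • (T.op h p.1 - p.1)) (𝓝[>] 0) (𝓝 p.2) := hp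
  rw [h0] at h
  simp only [map_zero, sub_zero, smul_zero] at h
  exact tendsto_nhds_unique h tendsto_const_nhds

theorem graph_generator : T.generator.graph = T.generatorGraph :=
  Submodule.toLinearPMap_graph_eq _ T.generatorGraph_single_valued

/-- `x ∈ D(A)` and `A x = y` iff `(T(h)x - x)/h → y` as `h ↓ 0`. -/
theorem generator_eq_iff (x y : X) :
    (∃ hx : x ∈ T.generator.domain, T.generator ⟨x, hx⟩ = y) ↔
      Tendsto (fun h : ℝ≥0 => (h : ℂ)⁻¹ • (T.op h x - x)) (𝓝[>] 0) (𝓝 y) := by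
  have h1 : (x, y) ∈ T.generator.graph ↔ (x, y) ∈ T.generatorGraph := by rw [graph_generator]
  refine Iff.trans ?_ h1
  rw [LinearPMap.mem_graph_iff]
  constructor
  · rintro ⟨hx, h⟩
    exact ⟨⟨x, hx⟩, rfl, h⟩
  · rintro ⟨⟨x', hx⟩, rfl, h⟩
    exact ⟨hx, h⟩

theorem tendsto_generator (x : T.generator.domain) :
    Tendsto (fun h : ℝ≥0 => (h : ℂ)⁻¹ • (T.op h (x : X) - x)) (𝓝[>] 0) (𝓝 (T.generator x)) :=
  (T.generator_eq_iff _ _).1 ⟨x.2, rfl⟩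

/-- `D(A)` is invariant under `T(t)` and `A T(t) x = T(t) A x` there. -/
theorem op_generator (t : ℝ≥0) (x : T.generator.domain) :
    ∃ h : T.op t (x : X) ∈ T.generator.domain,
      T.generator ⟨T.op t x, h⟩ = T.op t (T.generator x) := by
  rw [generator_eq_iff]
  refine (((T.op t).continuous.tendsto _).comp (T.tendsto_generator x)).congr fun h => ?_
  simp only [Function.comp, map_smul, map_sub]
  rw [← ContinuousLinearMap.comp_apply, ← T.op_add, ← ContinuousLinearMap.comp_apply,
    ← T.op_add, add_comm]

/-- `x ↦ β x - A x` on `D(A)`. -/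
noncomputable def shift (β : ℂ) : T.generator.domain →ₗ[ℂ] X :=
  β • T.generator.domain.subtype - T.generator.toFun

theorem shift_apply (β : ℂ) (x : T.generator.domain) :
    T.shift β x = β • (x : X) - T.generator x := rfl

/-- The resolvent set `ρ(A)`: all `β` such that `β - A : D(A) → X` has a bounded inverse. -/
def resolventSet : Set ℂ :=
  {β | ∃ R : X →L[ℂ] X, (∀ x, ∃ h : R x ∈ T.generator.domain, T.shift β ⟨R x, h⟩ = x) ∧
    ∀ x : T.generator.domain, R (T.shift β x) = x}

/-- The resolvent `R(β, A) = (β - A)⁻¹`. -/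
noncomputable def resolvent {β : ℂ} (hβ : β ∈ T.resolventSet) : X →L[ℂ] X := hβ.choose

variable {T}

theorem resolvent_mem {β : ℂ} (hβ : β ∈ T.resolventSet) (x : X) :
    T.resolvent hβ x ∈ T.generator.domain := (hβ.choose_spec.1 x).choose

theorem shift_resolvent {β : ℂ} (hβ : β ∈ T.resolventSet) (x : X) :
    T.shift β ⟨T.resolvent hβ x, resolvent_mem hβ x⟩ = x := (hβ.choose_spec.1 x).choose_spec

theorem resolvent_shift {β : ℂ} (hβ : β ∈ T.resolventSet) (x : T.generator.domain) :
    T.resolvent hβ (T.shift β x) = x := hβ.choose_spec.2 x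

theorem resolvent_injective {β : ℂ} (hβ : β ∈ T.resolventSet) :
    Function.Injective (T.resolvent hβ) := by
  intro x y h
  rw [← shift_resolvent hβ x, ← shift_resolvent hβ y]
  congr 1
  exact Subtype.ext h

theorem shift_injective {β : ℂ} (hβ : β ∈ T.resolventSet) : Function.Injective (T.shift β) := by
  intro x y h
  apply Subtype.ext
  rw [← resolvent_shift hβ x, ← resolvent_shift hβ y, h]

theorem resolvent_generator {β : ℂ} (hβ : β ∈ T.resolventSet) (x : T.generator.domain) :
    T.resolvent hβ (T.generator x) = β • T.resolvent hβ x - x := by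
  have h := resolvent_shift hβ x
  rw [shift_apply, map_sub, map_smul, sub_eq_iff_eq_add] at h
  rw [h]; abel

/-- The resolvent identity. -/
theorem resolvent_sub {α β : ℂ} (hα : α ∈ T.resolventSet) (hβ : β ∈ T.resolventSet) (x : X) :
    T.resolvent hα x - T.resolvent hβ x = (β - α) • T.resolvent hα (T.resolvent hβ x) := by
  have h1 := resolvent_shift hα ⟨_, resolvent_mem hβ x⟩
  have h2 := shift_resolvent hβ x
  rw [shift_apply] at h1 h2
  simp only [map_sub, map_smul] at h1 h2
  have h3 : T.resolvent hα (T.generator ⟨_, resolvent_mem hβ x⟩)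
      = β • T.resolvent hα (T.resolvent hβ x) - T.resolvent hα x := by
    rw [← map_smul, ← map_sub]
    congr 1
    rw [sub_eq_iff_eq_add] at h2
    rw [h2]
    abel
  rw [h3] at h1
  rw [sub_sub_eq_add_sub, sub_eq_iff_eq_add] at h1
  rw [sub_smul, sub_eq_sub_iff_add_eq_add, add_comm, h1, add_comm]

/-- The resolvent commutes with the semigroup. -/
theorem resolvent_op {β : ℂ} (hβ : β ∈ T.resolventSet) (t : ℝ≥0) (x : X) :
    T.resolvent hβ (T.op t x) = T.op t (T.resolvent hβ x) := by
  obtain ⟨h, e⟩ := T.op_generator t ⟨_, resolvent_mem hβ x⟩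
  have h1 := resolvent_shift hβ ⟨_, h⟩
  rw [shift_apply, e] at h1
  have h2 := shift_resolvent hβ x
  rw [shift_apply] at h2
  simp only at h1 h2
  rw [← map_smul, ← map_sub, h2] at h1
  exact h1

end Generator

section GrowthBound

variable {X : Type*} [NormedAddCommGroup X] [NormedSpace ℂ X] (T : C0Semigroup X)

/-- The growth bound `ω(T) = inf {ω ∈ ℝ | sup_{t>0} e^{-tω} ‖T(t)‖ < ∞}`; it may be `-∞`. -/
noncomputable def growthBound : EReal :=
  sInf ((fun w : ℝ => (w : EReal)) ''
    {w : ℝ | BddAbove (range fun t : Ioi (0 : ℝ≥0) => Real.exp (-(t : ℝ) * w) * ‖T.op t‖)})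

/-- The open right half-plane `{z | Re z > ω(T)}`. -/
def halfPlane : Set ℂ := {z | T.growthBound < (z.re : EReal)}

/-- The open sector `{z ≠ 0 | |arg z| < θ}`. -/
def sector (θ : ℝ) : Set ℂ := {z | z ≠ 0 ∧ |z.arg| < θ}

/-- The semigroup is analytic: for some `θ ∈ (0, π/2)` it extends analytically to the open sector
of half-angle `θ` and the extension has the semigroup property there. -/
def IsAnalyticSemigroup : Prop :=
  ∃ θ : ℝ, 0 < θ ∧ θ < Real.pi / 2 ∧ ∃ S : ℂ → X →L[ℂ] X,
    AnalyticOnNhd ℂ S (sector θ) ∧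
    (∀ z ∈ sector θ, ∀ w ∈ sector θ, S (z + w) = (S z).comp (S w)) ∧
    ∀ t : ℝ≥0, 0 < t → S ((t : ℝ) : ℂ) = T.op t

theorem continuous_orbit_real (x : X) : Continuous fun t : ℝ => T.op t.toNNReal x :=
  (T.continuous_orbit x).comp continuous_real_toNNReal

theorem exists_bound {z : ℂ} (hz : z ∈ T.halfPlane) :
    ∃ w M : ℝ, w < z.re ∧ 0 ≤ M ∧ ∀ t : ℝ≥0, ‖T.op t‖ ≤ M * Real.exp (w * t) := by
  have hz' : T.growthBound < (z.re : EReal) := hz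
  rw [growthBound, sInf_lt_iff] at hz'
  obtain ⟨_, ⟨w, ⟨M, hM⟩, rfl⟩, hlt⟩ := hz'
  refine ⟨w, max M 1, EReal.coe_lt_coe_iff.1 hlt, le_max_of_le_right zero_le_one, fun t => ?_⟩
  rcases eq_or_lt_of_le (zero_le (a := t)) with h0 | h0
  · rw [← h0, T.op_zero]
    simpa using Or.inr ContinuousLinearMap.norm_id_le
  · have h1 := hM ⟨⟨t, h0⟩, rfl⟩
    simp only at h1
    calc ‖T.op t‖ = (Real.exp (-(t : ℝ) * w) * ‖T.op t‖) * Real.exp (w * t) := by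
          rw [mul_right_comm, ← Real.exp_add]
          ring_nf
          simp
      _ ≤ max M 1 * Real.exp (w * t) := by
          gcongr
          exact h1.trans (le_max_left _ _)

end GrowthBound

section Analysis

variable {X : Type*} [NormedAddCommGroup X] [NormedSpace ℂ X] [CompleteSpace X]
  (T : C0Semigroup X)

/-- The averages `h⁻¹ ∫_0^h f` of a continuous function converge to `f 0` as `h ↓ 0`. -/
theorem tendsto_average {f : ℝ → X} (hf : Continuous f) :
    Tendsto (fun h : ℝ≥0 => (h : ℂ)⁻¹ • ∫ s in (0 : ℝ)..(h : ℝ), f s) (𝓝[>] 0) (𝓝 (f 0)) := by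
  have h1 : HasDerivAt (fun t : ℝ => ∫ s in (0 : ℝ)..t, f s) (f 0) 0 :=
    intervalIntegral.integral_hasDerivAt_right (hf.intervalIntegrable _ _)
      (hf.stronglyMeasurableAtFilter _ _) hf.continuousAt
  have h2 := h1.tendsto_slope_zero_right
  have h3 : Tendsto (fun h : ℝ≥0 => (h : ℝ)) (𝓝[>] 0) (𝓝[>] 0) := by
    refine tendsto_nhdsWithin_iff.2 ⟨?_, ?_⟩
    · exact (NNReal.continuous_coe.tendsto 0).mono_left nhdsWithin_le_nhds
    · filter_upwards [self_mem_nhdsWithin] with h hh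
      exact_mod_cast hh
  refine (h2.comp h3).congr fun h => ?_
  simp only [Function.comp, zero_add, intervalIntegral.integral_same, sub_zero]
  rw [← Complex.coe_smul, Complex.ofReal_inv]

theorem integral_orbit_mem (x : X) (a : ℝ≥0) :
    (∫ s in (0 : ℝ)..(a : ℝ), T.op s.toNNReal x) ∈ T.generator.domain := by
  have hc := T.continuous_orbit_real x
  suffices h : Tendsto (fun h : ℝ≥0 => (h : ℂ)⁻¹ •
      (T.op h (∫ s in (0 : ℝ)..(a : ℝ), T.op s.toNNReal x)
        - ∫ s in (0 : ℝ)..(a : ℝ), T.op s.toNNReal x)) (𝓝[>] 0) (𝓝 (T.op a x - x)) from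
    ((T.generator_eq_iff _ _).2 h).choose
  have hc2 : Continuous fun s : ℝ => T.op (s + a).toNNReal x :=
    hc.comp (continuous_id.add continuous_const)
  have h1 := (tendsto_average hc2).sub (tendsto_average hc)
  simp only [zero_add, Real.toNNReal_coe, Real.toNNReal_zero, T.op_zero,
    ContinuousLinearMap.id_apply] at h1
  refine h1.congr fun h => ?_
  rw [← smul_sub]
  congr 1
  have e1 : T.op h (∫ s in (0 : ℝ)..(a : ℝ), T.op s.toNNReal x)
      = ∫ s in (0 : ℝ)..(a : ℝ), T.op (s + h).toNNReal x := by
    rw [← ContinuousLinearMap.intervalIntegral_comp_comm _ (hc.intervalIntegrable _ _)]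
    refine intervalIntegral.integral_congr fun s hs => ?_
    rw [uIcc_of_le (NNReal.coe_nonneg a)] at hs
    rw [Real.toNNReal_add hs.1 (NNReal.coe_nonneg h), Real.toNNReal_coe, add_comm, T.op_add]
    rfl
  rw [e1, intervalIntegral.integral_comp_add_right (fun s => T.op s.toNNReal x),
    intervalIntegral.integral_comp_add_right (fun s => T.op s.toNNReal x)]
  simp only [zero_add]
  have i := fun p q : ℝ => hc.intervalIntegrable (μ := volume) p q
  rw [← intervalIntegral.integral_add_adjacent_intervals (i a 0) (i 0 (h + a)),
    ← intervalIntegral.integral_add_adjacent_intervals (i h 0) (i 0 (a + h)),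
    intervalIntegral.integral_symm 0 (a : ℝ), intervalIntegral.integral_symm 0 (h : ℝ),
    add_comm (h : ℝ) a]
  abel

/-- The domain of the generator is dense. -/
theorem dense_domain : Dense (T.generator.domain : Set X) := by
  intro x
  have h := tendsto_average (T.continuous_orbit_real x)
  simp only [Real.toNNReal_zero, T.op_zero, ContinuousLinearMap.id_apply] at h
  refine mem_closure_of_tendsto h (Eventually.of_forall fun a => ?_)
  exact T.generator.domain.smul_mem _ (T.integral_orbit_mem x a)

/-- The half-plane `Re z > ω(T)` lies in the resolvent set. -/
theorem halfPlane_subset : T.halfPlane ⊆ T.resolventSet := by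
  intro z hz
  obtain ⟨w, M, hw, hM0, hM⟩ := T.exists_bound hz
  set f : X → ℝ → X := fun x t => Complex.exp (-z * t) • T.op t.toNNReal x with hf
  have hfc : ∀ x, Continuous (f x) := fun x => by
    have := T.continuous_orbit_real x
    fun_prop
  have hb : ∀ x, ∀ t ∈ Ioi (0 : ℝ), ‖f x t‖ ≤ (M * ‖x‖) * Real.exp (-(z.re - w) * t) := by
    intro x t ht
    have ht' : ((t.toNNReal : ℝ≥0) : ℝ) = t := Real.coe_toNNReal t (le_of_lt ht)
    have h1 := (T.op t.toNNReal).le_of_opNorm_le (hM t.toNNReal) x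
    rw [ht'] at h1
    have h2 : ‖Complex.exp (-z * t)‖ = Real.exp (-z.re * t) := by
      rw [Complex.norm_exp]; simp
    calc ‖f x t‖ = Real.exp (-z.re * t) * ‖T.op t.toNNReal x‖ := by
          rw [hf]; simp only [norm_smul, h2]
      _ ≤ Real.exp (-z.re * t) * (M * Real.exp (w * t) * ‖x‖) := by gcongr
      _ = (M * ‖x‖) * (Real.exp (-z.re * t) * Real.exp (w * t)) := by ring
      _ = _ := by rw [← Real.exp_add]; ring_nf
  have hei : IntegrableOn (fun t : ℝ => Real.exp (-(z.re - w) * t)) (Ioi 0) :=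
    integrableOn_exp_mul_Ioi (by linarith) 0
  have hi : ∀ x, IntegrableOn (f x) (Ioi 0) := fun x =>
    (hei.const_mul (M * ‖x‖)).mono' (hfc x).aestronglyMeasurable
      ((ae_restrict_iff' measurableSet_Ioi).2 (Eventually.of_forall (hb x)))
  let R0 : X →ₗ[ℂ] X :=
    { toFun := fun x => ∫ t in Ioi (0 : ℝ), f x t
      map_add' := fun x y => by
        rw [← integral_add (hi x) (hi y)]
        simp [hf]
      map_smul' := fun c x => by
        rw [RingHom.id_apply, ← integral_smul]
        congr 1
        ext t
        simp only [hf, map_smul]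
        exact smul_comm _ _ _ }
  let R : X →L[ℂ] X := R0.mkContinuous (M * ∫ t in Ioi (0 : ℝ), Real.exp (-(z.re - w) * t)) (by
    intro x
    calc ‖∫ t in Ioi (0 : ℝ), f x t‖
        ≤ ∫ t in Ioi (0 : ℝ), (M * ‖x‖) * Real.exp (-(z.re - w) * t) :=
          norm_integral_le_of_norm_le (hei.const_mul _)
            ((ae_restrict_iff' measurableSet_Ioi).2 (Eventually.of_forall (hb x)))
      _ = _ := by rw [integral_const_mul]; ring)
  have hR : ∀ x, R x = ∫ t in Ioi (0 : ℝ), f x t := fun x => rfl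
  have hTR : ∀ (h : ℝ≥0) x, T.op h (R x) = R (T.op h x) := by
    intro h x
    rw [hR, hR, ← ContinuousLinearMap.integral_comp_comm _ (hi x)]
    congr 1
    ext t
    simp only [hf, map_smul]
    rw [← ContinuousLinearMap.comp_apply, ← T.op_add, ← ContinuousLinearMap.comp_apply,
      ← T.op_add, add_comm]
  have hsh : ∀ (h : ℝ≥0) x, T.op h (R x)
      = Complex.exp (z * h) • (R x - ∫ t in (0 : ℝ)..(h : ℝ), f x t) := by
    intro h x
    have e1 : R x - ∫ t in (0 : ℝ)..(h : ℝ), f x t = ∫ t in Ioi (h : ℝ), f x t := by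
      rw [hR, sub_eq_iff_eq_add, add_comm, intervalIntegral.integral_of_le (NNReal.coe_nonneg h),
        ← setIntegral_union (Ioc_disjoint_Ioi le_rfl) measurableSet_Ioi
          ((hi x).mono_set Ioc_subset_Ioi_self) ((hi x).mono_set (Ioi_subset_Ioi (NNReal.coe_nonneg h))),
        Ioc_union_Ioi_eq_Ioi (NNReal.coe_nonneg h)]
    have e2 : ∫ t in Ioi (h : ℝ), f x t = ∫ t in Ioi (0 : ℝ), f x (t + h) := by
      have := (measurePreserving_add_right (volume : Measure ℝ) (h : ℝ)).setIntegral_preimage_emb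
        (measurableEmbedding_addRight (h : ℝ)) (f x) (Ioi (h : ℝ))
      rw [← this]
      simp
    rw [e1, e2, hTR, hR, ← integral_smul]
    refine setIntegral_congr_fun measurableSet_Ioi fun t ht => ?_
    simp only [hf]
    rw [smul_smul, ← Complex.exp_add, Real.toNNReal_add (le_of_lt ht) (NNReal.coe_nonneg h),
      Real.toNNReal_coe, T.op_add, ContinuousLinearMap.comp_apply]
    congr 2
    push_cast
    ring
  have hlim : ∀ x, Tendsto (fun h : ℝ≥0 => (h : ℂ)⁻¹ • (T.op h (R x) - R x)) (𝓝[>] 0)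
      (𝓝 (z • R x - x)) := by
    intro x
    have d1 : Tendsto (fun h : ℝ≥0 => (h : ℂ)⁻¹ • ∫ s in (0 : ℝ)..(h : ℝ),
        (z * Complex.exp (z * s)) ) (𝓝[>] 0) (𝓝 z) := by
      have := tendsto_average (X := ℂ) (f := fun s : ℝ => z * Complex.exp (z * s)) (by fun_prop)
      simpa using this
    have d1' : Tendsto (fun h : ℝ≥0 => (h : ℂ)⁻¹ * (Complex.exp (z * h) - 1)) (𝓝[>] 0) (𝓝 z) := by
      refine d1.congr fun h => ?_
      rw [smul_eq_mul]
      congr 1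
      rw [intervalIntegral.integral_eq_sub_of_hasDerivAt
        (f := fun s : ℝ => Complex.exp (z * s))]
      · simp
      · intro s _
        have h3 : HasDerivAt (fun s : ℝ => z * (s : ℂ)) (z * 1) s :=
          (Complex.ofRealCLM.hasDerivAt (x := s)).const_mul z
        have h4 := h3.cexp
        exact h4.congr_deriv (by ring)
      · exact (by fun_prop : Continuous fun s : ℝ => z * Complex.exp (z * s)).intervalIntegrable _ _
    have d2 := tendsto_average (hfc x)
    have d2' : f x 0 = x := by simp [hf, T.op_zero]
    rw [d2'] at d2
    have d3 : Tendsto (fun h : ℝ≥0 => Complex.exp (z * h)) (𝓝[>] 0) (𝓝 1) := by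
      have : Continuous fun h : ℝ≥0 => Complex.exp (z * (h : ℝ)) := by fun_prop
      have := this.tendsto 0
      simp only [NNReal.coe_zero, Complex.ofReal_zero, mul_zero, Complex.exp_zero] at this
      exact this.mono_left nhdsWithin_le_nhds
    have d4 := (d1'.smul_const (R x)).sub (d3.smul d2)
    rw [one_smul] at d4
    refine d4.congr fun h => ?_
    rw [hsh]
    module
  refine ⟨R, fun x => ?_, fun x => ?_⟩
  · obtain ⟨h1, h2⟩ := (T.generator_eq_iff _ _).2 (hlim x)
    refine ⟨h1, ?_⟩
    rw [shift_apply, h2]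
    simp
  · have l1 := (R.continuous.tendsto _).comp (T.tendsto_generator x)
    have l2 := hlim x
    have e : R (T.generator x) = z • R (x : X) - x := by
      refine tendsto_nhds_unique l1 (l2.congr fun h => ?_)
      simp only [Function.comp, map_smul, map_sub, hTR]
    rw [shift_apply, map_sub, map_smul, e]
    simp

end Analysis

section Spaces

variable {X : Type*} [NormedAddCommGroup X] [NormedSpace ℂ X] (T : C0Semigroup X)
  (β : T.resolventSet)

/-- The space `X₁`: the domain `D(A)` with the norm `‖(β - A) x‖`. -/
def X1 (_ : T.resolventSet) : Type _ := T.generator.domain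

noncomputable instance : AddCommGroup (T.X1 β) :=
  inferInstanceAs (AddCommGroup T.generator.domain)

noncomputable instance : Module ℂ (T.X1 β) :=
  inferInstanceAs (Module ℂ T.generator.domain)

/-- `β - A : X₁ → X`. -/
noncomputable def X1.shift : T.X1 β →ₗ[ℂ] X := T.shift β

noncomputable instance : NormedAddCommGroup (T.X1 β) :=
  NormedAddCommGroup.induced (T.X1 β) X (X1.shift T β) (shift_injective β.2)

noncomputable instance : NormedSpace ℂ (T.X1 β) :=
  NormedSpace.induced ℂ (T.X1 β) X (X1.shift T β)

variable {T β} in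
/-- Element of `X₁` given by an element of `D(A)`. -/
def X1.mk (x : X) (hx : x ∈ T.generator.domain) : T.X1 β := ⟨x, hx⟩

variable {T β} in
/-- The inclusion `X₁ ⊆ X`. -/
def X1.val (x : T.X1 β) : X := Subtype.val (p := fun y => y ∈ T.generator.domain) x

theorem X1.norm_mk (x : X) (hx : x ∈ T.generator.domain) :
    ‖(X1.mk x hx : T.X1 β)‖ = ‖(β : ℂ) • x - T.generator ⟨x, hx⟩‖ := rfl

/-- `X` equipped with the norm `‖(β - A)⁻¹ x‖`. -/
def PreXm1 (_ : T.resolventSet) : Type _ := X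

noncomputable instance : AddCommGroup (T.PreXm1 β) := inferInstanceAs (AddCommGroup X)

noncomputable instance : Module ℂ (T.PreXm1 β) := inferInstanceAs (Module ℂ X)

/-- `(β - A)⁻¹` as a map on `X` with the weaker norm. -/
noncomputable def PreXm1.resolvent : T.PreXm1 β →ₗ[ℂ] X := (T.resolvent β.2).toLinearMap

noncomputable instance : NormedAddCommGroup (T.PreXm1 β) :=
  NormedAddCommGroup.induced (T.PreXm1 β) X (PreXm1.resolvent T β) (resolvent_injective β.2)

noncomputable instance : NormedSpace ℂ (T.PreXm1 β) :=
  NormedSpace.induced ℂ (T.PreXm1 β) X (PreXm1.resolvent T β)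

/-- The space `X₋₁`: the completion of `X` in the norm `‖(β - A)⁻¹ x‖`. -/
abbrev Xm1 : Type _ := UniformSpace.Completion (T.PreXm1 β)

/-- The identity map from `X` to `X` with the weaker norm. -/
def toPre : X →ₗ[ℂ] T.PreXm1 β := LinearMap.id (R := ℂ) (M := X)

/-- The canonical embedding `X → X₋₁`. -/
noncomputable def ι : X →L[ℂ] T.Xm1 β :=
  (UniformSpace.Completion.toComplL (𝕜 := ℂ) (E := T.PreXm1 β)).comp
    ((T.toPre β).mkContinuous ‖T.resolvent β.2‖ fun x => (T.resolvent β.2).le_opNorm x)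

theorem norm_ι (x : X) : ‖T.ι β x‖ = ‖T.resolvent β.2 x‖ :=
  UniformSpace.Completion.norm_coe (E := T.PreXm1 β) (T.toPre β x)

theorem denseRange_ι : DenseRange (T.ι β) :=
  UniformSpace.Completion.denseRange_coe (α := T.PreXm1 β)

/-- The extension `T₋₁(t)` of `T(t)` to `X₋₁` by continuity. -/
noncomputable def opExt (t : ℝ≥0) : T.Xm1 β →L[ℂ] T.Xm1 β :=
  ((T.ι β).comp (T.op t)).toLinearMap.extendOfNorm (T.ι β).toLinearMap

theorem opExt_ι (t : ℝ≥0) (x : X) : T.opExt β t (T.ι β x) = T.ι β (T.op t x) :=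
  LinearMap.extendOfNorm_eq (f := ((T.ι β).comp (T.op t)).toLinearMap)
    (e := (T.ι β).toLinearMap) (T.denseRange_ι β) ⟨‖T.op t‖, fun x => by
      simp only [ContinuousLinearMap.coe_coe, ContinuousLinearMap.comp_apply, norm_ι]
      rw [resolvent_op]
      exact (T.op t).le_opNorm _⟩ x

variable [CompleteSpace X]

/-- The extension `A₋₁ : X → X₋₁` of the generator `A` by continuity. -/
noncomputable def generatorExt : X →L[ℂ] T.Xm1 β :=
  ((T.ι β).toLinearMap.comp T.generator.toFun).extendOfNorm T.generator.domain.subtype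

theorem generatorExt_apply (x : T.generator.domain) :
    T.generatorExt β x = T.ι β (T.generator x) :=
  LinearMap.extendOfNorm_eq (f := (T.ι β).toLinearMap.comp T.generator.toFun)
    (e := T.generator.domain.subtype) (by simpa [DenseRange] using T.dense_domain)
    ⟨‖(β : ℂ)‖ * ‖T.resolvent β.2‖ + 1, fun x => by
      change ‖T.ι β (T.generator x)‖ ≤ _ * ‖(x : X)‖
      rw [norm_ι, resolvent_generator]
      calc _ ≤ ‖(β : ℂ) • T.resolvent β.2 x‖ + ‖(x : X)‖ := norm_sub_le _ _
        _ ≤ ‖(β : ℂ)‖ * (‖T.resolvent β.2‖ * ‖(x : X)‖) + ‖(x : X)‖ := by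
          rw [norm_smul]
          gcongr
          exact (T.resolvent β.2).le_opNorm _
        _ = _ := by ring⟩ x

variable {T}

/-- The extension of the resolvent `R(α, A)` to a bounded operator `X₋₁ → X`. -/
noncomputable def resolventExt {α : ℂ} (hα : α ∈ T.resolventSet) : T.Xm1 β →L[ℂ] X :=
  (T.resolvent hα).toLinearMap.extendOfNorm (T.ι β).toLinearMap

theorem resolventExt_ι {α : ℂ} (hα : α ∈ T.resolventSet) (x : X) :
    resolventExt β hα (T.ι β x) = T.resolvent hα x :=
  LinearMap.extendOfNorm_eq (f := (T.resolvent hα).toLinearMap)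
    (e := (T.ι β).toLinearMap) (T.denseRange_ι β)
    ⟨1 + ‖(β : ℂ) - α‖ * ‖T.resolvent hα‖, fun x => by
      simp only [ContinuousLinearMap.coe_coe, norm_ι]
      have h := resolvent_sub hα β.2 x
      rw [sub_eq_iff_eq_add] at h
      rw [h]
      calc _ ≤ ‖((β : ℂ) - α) • T.resolvent hα (T.resolvent β.2 x)‖ + ‖T.resolvent β.2 x‖ :=
            norm_add_le _ _
        _ ≤ ‖(β : ℂ) - α‖ * (‖T.resolvent hα‖ * ‖T.resolvent β.2 x‖) + ‖T.resolvent β.2 x‖ := by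
          rw [norm_smul]
          gcongr
          exact (T.resolvent hα).le_opNorm _
        _ = _ := by ring⟩ x

theorem resolventExt_sub {α α' : ℂ} (hα : α ∈ T.resolventSet) (hα' : α' ∈ T.resolventSet)
    (z : T.Xm1 β) : resolventExt β hα z - resolventExt β hα' z
      = (α' - α) • T.resolvent hα (resolventExt β hα' z) := by
  refine (T.denseRange_ι β).induction_on z (isClosed_eq (by fun_prop) (by fun_prop)) fun x => ?_
  simp only [resolventExt_ι]
  exact resolvent_sub hα hα' x

theorem resolventExt_sub_mem {α α' : ℂ} (hα : α ∈ T.resolventSet) (hα' : α' ∈ T.resolventSet)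
    (z : T.Xm1 β) :
    resolventExt β hα z - resolventExt β hα' z ∈ T.generator.domain := by
  rw [resolventExt_sub]
  exact T.generator.domain.smul_mem _ (resolvent_mem hα _)

/-- `R(α, A₋₁)(α - A₋₁) x = x` for `x ∈ X`. -/
theorem resolventExt_shift {α : ℂ} (hα : α ∈ T.resolventSet) (x : X) :
    resolventExt β hα (T.ι β (α • x) - T.generatorExt β x) = x := by
  rw [map_sub, resolventExt_ι, map_smul]
  have hc : Continuous fun x => α • T.resolvent hα x - resolventExt β hα (T.generatorExt β x) :=
    ((T.resolvent hα).continuous.const_smul α).sub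
      ((resolventExt β hα).continuous.comp (T.generatorExt β).continuous)
  refine isClosed_property (p := fun x =>
    α • T.resolvent hα x - resolventExt β hα (T.generatorExt β x) = x)
    T.dense_domain.denseRange_val (isClosed_eq hc continuous_id) (fun y => ?_) x
  rw [T.generatorExt_apply β y, resolventExt_ι, resolvent_generator]
  abel

end Spaces

end C0Semigroup

/-- A system node `Σ(A, B, C, G)` on `(U, X, Y)`. The number `β ∈ ρ(A)` fixes the norms of `X₁` and
`X₋₁`; different choices give equivalent norms. Only the values of `G` on the half-plane
`Re z > ω(T)` matter. -/
structure SystemNode (U X Y : Type*) [NormedAddCommGroup U] [NormedSpace ℂ U]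
    [NormedAddCommGroup X] [NormedSpace ℂ X] [CompleteSpace X]
    [NormedAddCommGroup Y] [NormedSpace ℂ Y] where
  /-- the semigroup generated by `A` -/
  T : C0Semigroup X
  /-- a point of `ρ(A)` -/
  β : T.resolventSet
  /-- the input operator -/
  B : U →L[ℂ] T.Xm1 β
  /-- the output operator -/
  C : T.X1 β →L[ℂ] Y
  /-- the transfer function -/
  G : ℂ → U →L[ℂ] Y
  analytic_G : AnalyticOnNhd ℂ G T.halfPlane
  /-- `G(α) - G(α') = C [R(α, A) - R(α', A)] B` -/
  G_sub : ∀ (α α' : ℂ) (hα : α ∈ T.halfPlane) (hα' : α' ∈ T.halfPlane) (u : U),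
    G α u - G α' u = C (C0Semigroup.X1.mk _ (C0Semigroup.resolventExt_sub_mem β
      (T.halfPlane_subset hα) (T.halfPlane_subset hα') (B u)))

namespace SystemNode

variable {U X Y : Type*} [NormedAddCommGroup U] [NormedSpace ℂ U]
  [NormedAddCommGroup X] [NormedSpace ℂ X] [CompleteSpace X]
  [NormedAddCommGroup Y] [NormedSpace ℂ Y] (N : SystemNode U X Y)

/-- The domain `{(x, u) ∈ X × U | A₋₁ x + B u ∈ X}` of `C&D`. -/
def domCD : Set (X × U) :=
  {p | ∃ v : X, N.T.ι N.β v = N.T.generatorExt N.β p.1 + N.B p.2}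

theorem sub_resolventExt_mem {p : X × U} (hp : p ∈ N.domCD) {γ : ℂ} (hγ : γ ∈ N.T.halfPlane) :
    p.1 - C0Semigroup.resolventExt N.β (N.T.halfPlane_subset hγ) (N.B p.2)
      ∈ N.T.generator.domain := by
  obtain ⟨v, hv⟩ := hp
  have h1 := C0Semigroup.resolventExt_shift N.β (N.T.halfPlane_subset hγ) p.1
  have h2 : p.1 - C0Semigroup.resolventExt N.β (N.T.halfPlane_subset hγ) (N.B p.2)
      = N.T.resolvent (N.T.halfPlane_subset hγ) (γ • p.1 - v) := by
    rw [← C0Semigroup.resolventExt_ι N.β, map_sub, hv]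
    nth_rewrite 1 [← h1]
    rw [← map_sub]
    congr 1
    abel
  rw [h2]
  exact C0Semigroup.resolvent_mem _ _

/-- The combined observation/feedthrough operator
`C&D (x, u) = C [x - R(γ, A) B u] + G(γ) u`, written with the point `γ` of the half-plane
`Re z > ω(T)`; the value does not depend on `γ`. -/
noncomputable def CD {p : X × U} (hp : p ∈ N.domCD) {γ : ℂ} (hγ : γ ∈ N.T.halfPlane) : Y :=
  N.C (C0Semigroup.X1.mk _ (N.sub_resolventExt_mem hp hγ)) + N.G γ p.2

/-- The triple `(u, x, y)` of functions on `[0, ∞)` is a classical solution of the system node. -/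
structure IsClassicalSolution (u : ℝ → U) (x : ℝ → X) (y : ℝ → Y) : Prop where
  continuous_input : ContinuousOn u (Ici 0)
  contDiff_state : ContDiffOn ℝ 1 x (Ici 0)
  continuous_output : ContinuousOn y (Ici 0)
  mem_dom : ∀ t, 0 ≤ t → (x t, u t) ∈ N.domCD
  state_eq : ∀ t, 0 ≤ t →
    N.T.ι N.β (derivWithin x (Ici 0) t) = N.T.generatorExt N.β (x t) + N.B (u t)
  output_eq : ∀ (t : ℝ) (ht : 0 ≤ t) (γ : ℂ) (hγ : γ ∈ N.T.halfPlane),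
    y t = N.CD (mem_dom t ht) hγ

/-- `C^∞`-BIBO stability: there is `c > 0` such that for all classical solutions `(u, x, y)` with
`x(0) = 0` and `u` smooth with compact support in `(0, ∞)`, the output `y` is bounded on `[0, ∞)`
and `sup ‖y‖ ≤ c sup ‖u‖`. -/
def IsSmoothBIBOStable : Prop :=
  ∃ c : ℝ, 0 < c ∧ ∀ (u : ℝ → U) (x : ℝ → X) (y : ℝ → Y),
    N.IsClassicalSolution u x y → x 0 = 0 →
    ContDiff ℝ ∞ u → HasCompactSupport u → tsupport u ⊆ Ioi 0 →
    BddAbove (range fun t : Ici (0 : ℝ) => ‖y t‖) ∧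
      (⨆ t : Ici (0 : ℝ), ‖y t‖) ≤ c * ⨆ t : Ici (0 : ℝ), ‖u t‖

end SystemNode

/-! The impulse response `C T₋₁(t) B` may be singular at `t = 0`, but stability controls it as a
functional on test functions, and duality turns this control into an `L¹` bound.

For `t > 0` analyticity makes `(β - A) T(t) = β S(t) - S'(t)` bounded on `X`. Two such factors, each
at time `t/2`, give the bounded operator `(β - A)² T(t)`. With `r = R(β, A₋₁) B : U → X`, the
operator `R(β, A) (β - A)² T(t) r` maps into `X₁` and equals `T₋₁(t) B` (`ι_ofResolvent_smoothing`).
It depends smoothly on `t > 0`, hence so does each scalar entry `k(t) = ℓ(C T₋₁(t) B u₀)`.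

Let `φ` be a test function with support in `(0, τ)` and take the input `u(s) = φ(τ - s) u₀`. At time
`τ` the input vanishes, so the feedthrough drops out and `ℓ(y(τ)) = ∫₀^τ φ k`
(`exists_output_eq_integral`). The required classical solution exists by
`exists_isClassicalSolution`, built from the variation of constants formula inside `X`. Stability
now gives `|∫ φ k| ≤ ‖ℓ‖ c ‖u₀‖` whenever `|φ| ≤ 1`, with a constant independent of `τ`.

Choosing `φ` as a smooth approximation of the conjugate phase of `k` bounds `∫_a^b |k|` uniformly in
`0 < a < b` (`integral_norm_le_of_forall_testFunction`), so `k` is integrable on `(0, ∞)`. Since `U`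
and `Y` are finite-dimensional, integrability of all entries is integrability in operator norm. -/

namespace C0Semigroup

/-! ### Exponential bounds and the inhomogeneous Cauchy problem. -/

section Duhamel

variable {X : Type*} [NormedAddCommGroup X] [NormedSpace ℂ X] [CompleteSpace X]
  (T : C0Semigroup X)

/-- Every strongly continuous semigroup is exponentially bounded. -/
theorem exists_norm_op_le : ∃ M w : ℝ, 0 ≤ M ∧ ∀ t : ℝ≥0, ‖T.op t‖ ≤ M * Real.exp (w * t) := by
  obtain ⟨C, hC⟩ : ∃ C, ∀ t : Icc (0 : ℝ≥0) 1, ‖T.op t‖ ≤ C := by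
    refine banach_steinhaus fun x => ?_
    obtain ⟨C, hC⟩ := (isCompact_Icc (a := (0 : ℝ≥0)) (b := 1)).exists_bound_of_continuousOn
      (T.continuous_orbit x).continuousOn
    exact ⟨C, fun t => hC t t.2⟩
  -- The bound is raised to at least `1` so that `log M ≥ 0`, which lets `⌊t⌋` be replaced by `t` in
  -- the exponent at the end.
  set M := max C 1 with hMdef
  have hM1 : 1 ≤ M := le_max_right _ _
  have hM0 : 0 < M := zero_lt_one.trans_le hM1
  have hM : ∀ t : ℝ≥0, t ≤ 1 → ‖T.op t‖ ≤ M := fun t ht =>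
    (hC ⟨t, zero_le, ht⟩).trans (le_max_left _ _)
  have hn : ∀ (n : ℕ) (t : ℝ≥0), t ≤ 1 → ‖T.op (n + t)‖ ≤ M ^ (n + 1) := by
    intro n
    induction n with
    | zero => intro t ht; simpa using hM t ht
    | succ n ih =>
      intro t ht
      have e : ((n + 1 : ℕ) : ℝ≥0) + t = 1 + (n + t) := by push_cast; ring
      rw [e, T.op_add, pow_succ']
      exact (ContinuousLinearMap.opNorm_comp_le _ _).trans
        (mul_le_mul (hM 1 le_rfl) (ih t ht) (norm_nonneg _) hM0.le)
  refine ⟨M, Real.log M, hM0.le, fun t => ?_⟩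
  have h1 : (⌊t⌋₊ : ℝ≥0) ≤ t := Nat.floor_le zero_le
  have h2 : t - ⌊t⌋₊ ≤ 1 := by
    rw [tsub_le_iff_left]
    exact (Nat.lt_floor_add_one t).le
  have h3 := hn ⌊t⌋₊ (t - ⌊t⌋₊) h2
  rw [add_tsub_cancel_of_le h1] at h3
  refine h3.trans ?_
  rw [pow_succ', mul_comm (Real.log M), ← Real.rpow_natCast]
  gcongr
  rw [Real.rpow_def_of_pos hM0, mul_comm (Real.log M)]
  have h4 : ((⌊t⌋₊ : ℕ) : ℝ) ≤ t := by exact_mod_cast h1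
  have := Real.log_nonneg hM1
  gcongr

/-- The exponential bound keeps the growth bound below `+∞`. This supplies the point `γ` needed to
evaluate `C&D`. -/
theorem halfPlane_nonempty : T.halfPlane.Nonempty := by
  obtain ⟨M, w, -, h⟩ := T.exists_norm_op_le
  refine ⟨((w + 1 : ℝ) : ℂ), ?_⟩
  refine lt_of_le_of_lt (b := (w : EReal)) (sInf_le ⟨w, ⟨M, ?_⟩, rfl⟩) ?_
  · rintro _ ⟨t, rfl⟩
    calc _ ≤ Real.exp (-(t : ℝ≥0) * w) * (M * Real.exp (w * (t : ℝ≥0))) :=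
          mul_le_mul_of_nonneg_left (h t) (Real.exp_pos _).le
      _ = M * (Real.exp (-(t : ℝ≥0) * w) * Real.exp (w * (t : ℝ≥0))) := by ring
      _ = M := by rw [← Real.exp_add]; ring_nf; simp
  · exact_mod_cast (by simp : w < w + 1)

/-- The map `(t, x) ↦ T(t) x` is jointly continuous. -/
theorem continuous_op_apply : Continuous fun p : ℝ≥0 × X => T.op p.1 p.2 := by
  obtain ⟨M, w, hM0, h⟩ := T.exists_norm_op_le
  rw [continuous_iff_continuousAt]
  rintro ⟨t, x⟩
  have h1 : Tendsto (fun p : ℝ≥0 × X => T.op p.1 (p.2 - x)) (𝓝 (t, x)) (𝓝 0) := by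
    refine squeeze_zero_norm (a := fun p : ℝ≥0 × X => M * Real.exp (w * p.1) * ‖p.2 - x‖)
      (fun p => (T.op p.1).le_of_opNorm_le (h p.1) _) ?_
    have : Continuous fun p : ℝ≥0 × X => M * Real.exp (w * p.1) * ‖p.2 - x‖ := by fun_prop
    simpa using this.tendsto (t, x)
  have h2 : Tendsto (fun p : ℝ≥0 × X => T.op p.1 x) (𝓝 (t, x)) (𝓝 (T.op t x)) :=
    ((T.continuous_orbit x).comp continuous_fst).tendsto (t, x)
  have h3 := h1.add h2
  rw [zero_add] at h3
  refine h3.congr fun p => ?_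
  simp

theorem continuous_op_comp {E : Type*} [TopologicalSpace E] {a : E → ℝ} {f : E → X}
    (ha : Continuous a) (hf : Continuous f) : Continuous fun e => T.op (a e).toNNReal (f e) :=
  T.continuous_op_apply.comp ((continuous_real_toNNReal.comp ha).prodMk hf)

/-- The convolution `∫_0^t T(s) f(t - s) ds`. -/
noncomputable def duhamel (f : ℝ → X) (t : ℝ) : X :=
  ∫ s in (0 : ℝ)..t, T.op s.toNNReal (f (t - s))

variable {T} {f : ℝ → X}

/-- For `s ≥ t` the factor `f (t - s)` vanishes. A fixed upper limit makes differentiation under the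
integral sign possible. -/
theorem duhamel_eq_of_le (hf : Continuous f) (hf0 : ∀ t ≤ 0, f t = 0) {t b : ℝ} (htb : t ≤ b) :
    T.duhamel f t = ∫ s in (0 : ℝ)..b, T.op s.toNNReal (f (t - s)) := by
  have hc : Continuous fun s : ℝ => T.op s.toNNReal (f (t - s)) :=
    T.continuous_op_comp continuous_id (by fun_prop)
  have h0 : ∫ s in t..b, T.op s.toNNReal (f (t - s)) = 0 := by
    rw [intervalIntegral.integral_congr (g := fun _ => (0 : X))]
    · simp
    · intro s hs
      rw [uIcc_of_le htb] at hs
      simp only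
      rw [hf0 _ (by linarith [hs.1]), map_zero]
  rw [← intervalIntegral.integral_add_adjacent_intervals (hc.intervalIntegrable 0 t)
    (hc.intervalIntegrable t b), h0, add_zero, duhamel]

omit [CompleteSpace X] in
theorem duhamel_zero : T.duhamel f 0 = 0 := by simp [duhamel]

theorem duhamel_sub {g : ℝ → X} (hf : Continuous f) (hg : Continuous g) (t : ℝ) :
    T.duhamel (fun s => f s - g s) t = T.duhamel f t - T.duhamel g t := by
  simp only [duhamel, map_sub]
  exact intervalIntegral.integral_sub
    ((T.continuous_op_comp continuous_id (by fun_prop)).intervalIntegrable _ _)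
    ((T.continuous_op_comp continuous_id (by fun_prop)).intervalIntegrable _ _)

omit [CompleteSpace X] in
theorem duhamel_smul (c : ℂ) (t : ℝ) :
    T.duhamel (fun s => c • f s) t = c • T.duhamel f t := by
  simp only [duhamel, map_smul]
  exact intervalIntegral.integral_smul _ _

theorem continuous_duhamel (hf : Continuous f) : Continuous (T.duhamel f) := by
  have hc : Continuous (Function.uncurry fun t s : ℝ => T.op s.toNNReal (f (t - s))) :=
    T.continuous_op_comp continuous_snd (by fun_prop)
  exact intervalIntegral.continuous_parametric_intervalIntegral_of_continuous hc continuous_id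

/-- In `∫ T(s) f(t - s) ds` the variable `t` occurs only in `f`, so no differentiability of the
orbits is needed; there is no boundary term because `f` vanishes at `0`. -/
theorem hasDerivAt_duhamel {f' : ℝ → X} (hf : ∀ t, HasDerivAt f (f' t) t) (hf' : Continuous f')
    (hf0 : ∀ t ≤ 0, f t = 0) (hf0' : ∀ t ≤ 0, f' t = 0) (t : ℝ) :
    HasDerivAt (T.duhamel f) (T.duhamel f' t) t := by
  have hfc : Continuous f := continuous_iff_continuousAt.2 fun t => (hf t).continuousAt
  set b := t + 1 with hb
  have hc : Continuous (Function.uncurry fun τ s : ℝ => T.op s.toNNReal (f' (τ - s))) :=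
    T.continuous_op_comp continuous_snd (by fun_prop)
  obtain ⟨K, hK⟩ := ((isCompact_Icc (a := t - 1) (b := t + 1)).prod
    (isCompact_uIcc (a := (0 : ℝ)) (b := b))).exists_bound_of_continuousOn hc.continuousOn
  have hcs : ∀ τ, Continuous fun s : ℝ => T.op s.toNNReal (f (τ - s)) := fun τ =>
    T.continuous_op_comp continuous_id (by fun_prop)
  have hcs' : ∀ τ, Continuous fun s : ℝ => T.op s.toNNReal (f' (τ - s)) := fun τ =>
    T.continuous_op_comp continuous_id (by fun_prop)
  have h := (intervalIntegral.hasDerivAt_integral_of_dominated_loc_of_deriv_le (𝕜 := ℝ) (μ := volume)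
    (F := fun τ s : ℝ => T.op s.toNNReal (f (τ - s)))
    (F' := fun τ s : ℝ => T.op s.toNNReal (f' (τ - s))) (x₀ := t) (a := 0) (b := b)
    (bound := fun _ => K) (Ioo_mem_nhds (by linarith : t - 1 < t) (by linarith : t < t + 1))
    (Eventually.of_forall fun τ => (hcs τ).aestronglyMeasurable)
    ((hcs t).intervalIntegrable _ _) (hcs' t).aestronglyMeasurable
    (Eventually.of_forall fun s hs τ hτ => hK (τ, s) ⟨Ioo_subset_Icc_self hτ, uIoc_subset_uIcc hs⟩)
    (intervalIntegrable_const)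
    (Eventually.of_forall fun s _ τ _ => by
      have h1 : HasDerivAt (fun τ => f (τ - s)) (f' (τ - s)) τ := (hf (τ - s)).comp_sub_const τ s
      exact ((T.op s.toNNReal).restrictScalars ℝ).hasFDerivAt.comp_hasDerivAt τ h1)).2
  rw [duhamel_eq_of_le hf' hf0' (by linarith : t ≤ b)]
  refine h.congr_of_eventuallyEq ?_
  filter_upwards [Iio_mem_nhds (by linarith : t < b)] with τ hτ
  exact duhamel_eq_of_le hfc hf0 (le_of_lt hτ)

/-- The convolution solves `w' = A w + f`. -/
theorem tendsto_duhamel_slope {f' : ℝ → X} (hf : ∀ t, HasDerivAt f (f' t) t) (hf' : Continuous f')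
    (hf0 : ∀ t ≤ 0, f t = 0) (hf0' : ∀ t ≤ 0, f' t = 0) {t : ℝ} (ht : 0 ≤ t) :
    Tendsto (fun h : ℝ≥0 => (h : ℂ)⁻¹ • (T.op h (T.duhamel f t) - T.duhamel f t)) (𝓝[>] 0)
      (𝓝 (T.duhamel f' t - f t)) := by
  have hfc : Continuous f := continuous_iff_continuousAt.2 fun t => (hf t).continuousAt
  have hcs : ∀ τ, Continuous fun s : ℝ => T.op s.toNNReal (f (τ - s)) := fun τ =>
    T.continuous_op_comp continuous_id (by fun_prop)
  have hpos : Tendsto (fun h : ℝ≥0 => (h : ℝ)) (𝓝[>] 0) (𝓝[>] 0) := by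
    refine tendsto_nhdsWithin_iff.2 ⟨?_, ?_⟩
    · exact (NNReal.continuous_coe.tendsto 0).mono_left nhdsWithin_le_nhds
    · filter_upwards [self_mem_nhdsWithin] with h hh
      exact_mod_cast hh
  have h1 := ((hasDerivAt_duhamel (T := T) hf hf' hf0 hf0' t).tendsto_slope_zero_right).comp hpos
  -- The integrand depends on `h` as well as `s`, so the plain averaging lemma does not apply; joint
  -- continuity at `(0, 0)` does the work.
  have h2 : Tendsto (fun h : ℝ≥0 => (h : ℂ)⁻¹ •
      ∫ s in (0 : ℝ)..(h : ℝ), T.op s.toNNReal (f (t + h - s))) (𝓝[>] 0) (𝓝 (f t)) := by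
    rw [Metric.tendsto_nhds]
    intro ε hε
    have hc : Continuous fun p : ℝ × ℝ => T.op p.2.toNNReal (f (t + p.1 - p.2)) :=
      T.continuous_op_comp continuous_snd (by fun_prop)
    have h3 := hc.tendsto (0, 0)
    simp only [add_zero, sub_zero, Real.toNNReal_zero, T.op_zero,
      ContinuousLinearMap.id_apply] at h3
    obtain ⟨δ, hδ, h4⟩ := Metric.tendsto_nhds_nhds.1 h3 (ε / 2) (half_pos hε)
    have h5 : ∀ᶠ h : ℝ≥0 in 𝓝[>] 0, (h : ℝ) < δ :=
      ((NNReal.continuous_coe.tendsto 0).mono_left nhdsWithin_le_nhds).eventually_lt_const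
        (by simpa using hδ)
    filter_upwards [h5, self_mem_nhdsWithin] with h h6 h7
    have h7' : (0 : ℝ) < h := by exact_mod_cast h7
    have e : (h : ℂ)⁻¹ • (∫ s in (0 : ℝ)..(h : ℝ), T.op s.toNNReal (f (t + h - s))) - f t
        = (h : ℂ)⁻¹ • ∫ s in (0 : ℝ)..(h : ℝ), (T.op s.toNNReal (f (t + h - s)) - f t) := by
      rw [intervalIntegral.integral_sub ((hcs _).intervalIntegrable _ _)
        intervalIntegrable_const, smul_sub, intervalIntegral.integral_const, sub_zero,
        ← Complex.coe_smul (h : ℝ) (f t), smul_smul, inv_mul_cancel₀, one_smul]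
      exact_mod_cast h7'.ne'
    rw [dist_eq_norm, e, norm_smul]
    have h8 := intervalIntegral.norm_integral_le_of_norm_le_const (a := (0 : ℝ)) (b := h)
      (f := fun s : ℝ => T.op s.toNNReal (f (t + h - s)) - f t) (C := ε / 2) (by
        intro s hs
        rw [uIoc_of_le h7'.le] at hs
        rw [← dist_eq_norm]
        refine (h4 (x := ((h : ℝ), s)) ?_).le
        rw [Prod.dist_eq, max_lt_iff, Real.dist_0_eq_abs, Real.dist_0_eq_abs, abs_of_pos h7',
          abs_of_pos hs.1]
        exact ⟨h6, hs.2.trans_lt h6⟩)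
    rw [sub_zero, abs_of_pos h7'] at h8
    have h9 : ‖(h : ℂ)⁻¹‖ = (h : ℝ)⁻¹ := by
      rw [norm_inv, Complex.norm_real, Real.norm_of_nonneg h7'.le]
    rw [h9]
    calc _ ≤ (h : ℝ)⁻¹ * (ε / 2 * h) := by gcongr
      _ = ε / 2 := by field_simp
      _ < ε := half_lt_self hε
  refine (h1.sub h2).congr fun h => ?_
  simp only [Function.comp]
  -- The shift `s ↦ s + h` gives `T(h) w(t) = w(t + h) - ∫₀^h T(s) f(t + h - s) ds`. Dividing by `h`
  -- leaves `w'(t) - f(t)` in the limit.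
  have e1 : T.op h (T.duhamel f t)
      = T.duhamel f (t + h) - ∫ s in (0 : ℝ)..(h : ℝ), T.op s.toNNReal (f (t + h - s)) := by
    rw [duhamel, ← ContinuousLinearMap.intervalIntegral_comp_comm _
      ((hcs t).intervalIntegrable _ _), eq_sub_iff_add_eq, add_comm, duhamel,
      ← intervalIntegral.integral_add_adjacent_intervals
        ((hcs (t + h)).intervalIntegrable 0 h) ((hcs (t + h)).intervalIntegrable h (t + h))]
    congr 1
    have := intervalIntegral.integral_comp_add_right (a := 0) (b := t)
      (fun s => T.op s.toNNReal (f (t + h - s))) (h : ℝ)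
    rw [zero_add] at this
    rw [← this]
    refine intervalIntegral.integral_congr fun s hs => ?_
    rw [uIcc_of_le ht] at hs
    rw [Real.toNNReal_add hs.1 (NNReal.coe_nonneg h), Real.toNNReal_coe, add_comm s.toNNReal,
      T.op_add, add_sub_add_right_eq_sub]
    rfl
  rw [e1, ← Complex.coe_smul, Complex.ofReal_inv, ← smul_sub]
  congr 1
  abel

/-- For `w = T * f` the previous result reads `A w = T * f' - f`, hence `(β - A) w = T * (β f - f')
+ f`; apply the resolvent. -/
theorem resolvent_duhamel {β : ℂ} (hβ : β ∈ T.resolventSet) {f' : ℝ → X}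
    (hf : ∀ t, HasDerivAt f (f' t) t) (hf' : Continuous f')
    (hf0 : ∀ t ≤ 0, f t = 0) (hf0' : ∀ t ≤ 0, f' t = 0) {t : ℝ} (ht : 0 ≤ t) :
    T.resolvent hβ (T.duhamel (fun s => β • f s - f' s) t + f t) = T.duhamel f t := by
  have hfc : Continuous f := continuous_iff_continuousAt.2 fun t => (hf t).continuousAt
  obtain ⟨h1, h2⟩ := (T.generator_eq_iff _ _).2 (tendsto_duhamel_slope hf hf' hf0 hf0' ht)
  have h3 := resolvent_shift hβ ⟨_, h1⟩
  rw [shift_apply, h2] at h3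
  simp only at h3
  rw [duhamel_sub (by fun_prop) hf', duhamel_smul]
  convert h3 using 2
  abel

end Duhamel

end C0Semigroup

/-! ### Smoothing by an analytic semigroup. -/

namespace C0Semigroup

section Analytic

variable {X : Type*} [NormedAddCommGroup X] [NormedSpace ℂ X] {T : C0Semigroup X}

theorem ofReal_mem_sector {θ : ℝ} (hθ : 0 < θ) {t : ℝ} (ht : 0 < t) : (t : ℂ) ∈ sector θ := by
  refine ⟨by exact_mod_cast ht.ne', ?_⟩
  rw [Complex.arg_ofReal_of_nonneg ht.le]
  simpa using hθ

/-- `(β - A) T(t)` for an operator-valued function `S` extending the semigroup to a complex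
neighbourhood of `(0, ∞)`. -/
noncomputable def shiftOp (S : ℂ → X →L[ℂ] X) (β : ℂ) (t : ℝ) : X →L[ℂ] X :=
  β • S t - deriv S t

variable {θ : ℝ} {S : ℂ → X →L[ℂ] X}

/-- Since `T(h) T(t) x = S(t + h) x`, the difference quotient defining `A T(t) x` is that of the
differentiable map `S` at `t`, so `A T(t) x = S'(t) x`. -/
theorem shift_op_eq_shiftOp (hθ : 0 < θ) (hS : AnalyticOnNhd ℂ S (sector θ))
    (hST : ∀ t : ℝ≥0, 0 < t → S ((t : ℝ) : ℂ) = T.op t) {t : ℝ≥0} (ht : 0 < t) (β : ℂ) (x : X) :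
    ∃ h : T.op t x ∈ T.generator.domain, T.shift β ⟨T.op t x, h⟩ = shiftOp S β t x := by
  have ht' : (0 : ℝ) < t := by exact_mod_cast ht
  have hd : HasDerivAt S (deriv S ((t : ℝ) : ℂ)) ((t : ℝ) : ℂ) :=
    (hS _ (ofReal_mem_sector hθ ht')).differentiableAt.hasDerivAt
  have hd2 : HasDerivAt (fun z => S z x) (deriv S ((t : ℝ) : ℂ) x) ((t : ℝ) : ℂ) :=
    hd.clm_apply (hasDerivAt_const _ x) |>.congr_deriv (by simp)
  have hpos : Tendsto (fun h : ℝ≥0 => ((h : ℝ) : ℂ)) (𝓝[>] 0) (𝓝[≠] 0) := by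
    refine tendsto_nhdsWithin_iff.2 ⟨?_, ?_⟩
    · have : Continuous fun h : ℝ≥0 => ((h : ℝ) : ℂ) := by fun_prop
      simpa using (this.tendsto 0).mono_left (nhdsWithin_le_nhds (s := Ioi 0))
    · filter_upwards [self_mem_nhdsWithin] with h hh
      have : (0 : ℝ) < h := by exact_mod_cast hh
      exact Complex.ofReal_ne_zero.2 this.ne'
  obtain ⟨h1, h2⟩ := (T.generator_eq_iff (T.op t x) (deriv S ((t : ℝ) : ℂ) x)).2 (by
    refine (hd2.tendsto_slope_zero.comp hpos).congr' ?_
    filter_upwards [self_mem_nhdsWithin] with h hh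
    have e : S (((t : ℝ) : ℂ) + ((h : ℝ) : ℂ)) = T.op (h + t) := by
      rw [← hST _ (by positivity), add_comm h]
      push_cast
      rfl
    simp only [Function.comp, e, hST t ht, T.op_add]
    rfl)
  refine ⟨h1, ?_⟩
  rw [shift_apply, h2, shiftOp, hST t ht]
  rfl

theorem resolvent_shiftOp (hθ : 0 < θ) (hS : AnalyticOnNhd ℂ S (sector θ))
    (hST : ∀ t : ℝ≥0, 0 < t → S ((t : ℝ) : ℂ) = T.op t) {t : ℝ≥0} (ht : 0 < t)
    {β : ℂ} (hβ : β ∈ T.resolventSet) (x : X) :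
    T.resolvent hβ (shiftOp S β t x) = T.op t x := by
  obtain ⟨h1, h2⟩ := shift_op_eq_shiftOp hθ hS hST ht β x
  rw [← h2, resolvent_shift]

theorem shiftOp_resolvent (hθ : 0 < θ) (hS : AnalyticOnNhd ℂ S (sector θ))
    (hST : ∀ t : ℝ≥0, 0 < t → S ((t : ℝ) : ℂ) = T.op t) {t : ℝ≥0} (ht : 0 < t)
    {β : ℂ} (hβ : β ∈ T.resolventSet) (x : X) :
    shiftOp S β t (T.resolvent hβ x) = T.op t x := by
  obtain ⟨h1, h2⟩ := shift_op_eq_shiftOp hθ hS hST ht β (T.resolvent hβ x)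
  rw [← h2, ← shift_resolvent hβ (T.op t x)]
  congr 2
  exact (resolvent_op hβ t x).symm

end Analytic

section Smoothing

variable {X : Type*} [NormedAddCommGroup X] [NormedSpace ℂ X] (T : C0Semigroup X)
  (β : T.resolventSet)

/-- The resolvent `R(β, A)` as an isometry `X → X₁`. -/
noncomputable def X1.ofResolvent : X →L[ℂ] T.X1 β :=
  LinearMap.mkContinuous
    { toFun := fun x => X1.mk (T.resolvent β.2 x) (resolvent_mem β.2 x)
      map_add' := fun x y => Subtype.ext (map_add (T.resolvent β.2) x y)
      map_smul' := fun c x => Subtype.ext (map_smul (T.resolvent β.2) c x) } 1 (by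
    intro x
    rw [one_mul]
    exact le_of_eq (congrArg norm (shift_resolvent β.2 x)))

theorem X1.val_ofResolvent (x : X) : (X1.ofResolvent T β x).val = T.resolvent β.2 x := rfl

variable {T β}

theorem X1.ext {x y : T.X1 β} (h : x.val = y.val) : x = y := Subtype.ext h

/-- Elements of `X₁` are handled as `R(β, A) z` with `z ∈ X`, so that `C` is replaced by the bounded
operator `C R(β, A)` on `X`. -/
theorem X1.mk_eq_ofResolvent {x z : X} (hx : x ∈ T.generator.domain)
    (h : T.resolvent β.2 z = x) : (X1.mk x hx : T.X1 β) = X1.ofResolvent T β z :=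
  X1.ext h.symm

/-- The operator `(β - A)² T(t)`, bounded on `X` for `t > 0`. -/
noncomputable def smoothing (S : ℂ → X →L[ℂ] X) (β : T.resolventSet) (t : ℝ) : X →L[ℂ] X :=
  (shiftOp S β (t / 2)).comp (shiftOp S β (t / 2))

variable {θ : ℝ} {S : ℂ → X →L[ℂ] X}

theorem resolvent_resolvent_smoothing (hθ : 0 < θ) (hS : AnalyticOnNhd ℂ S (sector θ))
    (hST : ∀ t : ℝ≥0, 0 < t → S ((t : ℝ) : ℂ) = T.op t) {t : ℝ} (ht : 0 < t) (x : X) :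
    T.resolvent β.2 (T.resolvent β.2 (smoothing S β t x)) = T.op t.toNNReal x := by
  have ht2 : 0 < (t / 2).toNNReal := Real.toNNReal_pos.2 (half_pos ht)
  have e : t / 2 = ((t / 2).toNNReal : ℝ) := (Real.coe_toNNReal _ (half_pos ht).le).symm
  have e2 : t.toNNReal = (t / 2).toNNReal + (t / 2).toNNReal := by
    rw [← Real.toNNReal_add (half_pos ht).le (half_pos ht).le, add_halves]
  rw [smoothing, ContinuousLinearMap.comp_apply, e, resolvent_shiftOp hθ hS hST ht2,
    resolvent_op, resolvent_shiftOp hθ hS hST ht2, e2, T.op_add]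
  rfl

/-- On the dense image of `X`, the outer resolvent cancels one factor `(β - A)` and the inner one
cancels the other, leaving `T(t/2) T(t/2) = T(t)`. -/
theorem ι_ofResolvent_smoothing [CompleteSpace X] (hθ : 0 < θ)
    (hS : AnalyticOnNhd ℂ S (sector θ))
    (hST : ∀ t : ℝ≥0, 0 < t → S ((t : ℝ) : ℂ) = T.op t) {t : ℝ≥0} (ht : 0 < t)
    (z : T.Xm1 β) :
    T.ι β (X1.ofResolvent T β (smoothing S β t (resolventExt β β.2 z))).val
      = T.opExt β t z := by
  simp only [X1.val_ofResolvent]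
  refine (T.denseRange_ι β).induction_on z (isClosed_eq (by fun_prop) (by fun_prop)) fun x => ?_
  rw [resolventExt_ι, opExt_ι]
  congr 1
  have ht2 : 0 < t / 2 := half_pos ht
  have e : (t : ℝ) / 2 = ((t / 2 : ℝ≥0) : ℝ) := by push_cast; rfl
  rw [smoothing, ContinuousLinearMap.comp_apply, e, resolvent_shiftOp hθ hS hST ht2,
    shiftOp_resolvent hθ hS hST ht2, ← ContinuousLinearMap.comp_apply, ← T.op_add, add_halves]

/-- The map is a product of two holomorphic operator functions, restricted to the real axis. -/
theorem contDiffAt_smoothing [CompleteSpace X] (hθ : 0 < θ) (hS : AnalyticOnNhd ℂ S (sector θ))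
    {t : ℝ} (ht : 0 < t) : ContDiffAt ℝ ∞ (smoothing S β) t := by
  have h1 : ((t : ℂ) / 2) ∈ sector θ := by
    exact_mod_cast ofReal_mem_sector hθ (half_pos ht)
  have h2 : AnalyticAt ℂ (fun z => (β : ℂ) • S z - deriv S z) ((t : ℂ) / 2) :=
    ((hS _ h1).const_smul (c := (β : ℂ))).sub (hS.deriv _ h1)
  have h3 : ContDiffAt ℂ ∞ (fun z : ℂ => (β : ℂ) • S (z / 2) - deriv S (z / 2)) (t : ℂ) :=
    ContDiffAt.comp (g := fun z => (β : ℂ) • S z - deriv S z) (t : ℂ) h2.contDiffAt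
      (contDiffAt_id.div_const 2)
  have h4 : ContDiffAt ℝ ∞ (fun z : ℂ => ((β : ℂ) • S (z / 2) - deriv S (z / 2)).comp
      ((β : ℂ) • S (z / 2) - deriv S (z / 2))) (t : ℂ) := (h3.clm_comp h3).restrict_scalars ℝ
  have h5 := h4.comp t Complex.ofRealCLM.contDiff.contDiffAt
  refine h5.congr_of_eventuallyEq (Eventually.of_forall fun s => ?_)
  simp [smoothing, shiftOp]

end Smoothing

end C0Semigroup

/-! ### `L¹` bounds by duality with test functions. -/

/-- A smooth function multiplied by a smooth cutoff is smooth everywhere. -/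
theorem contDiff_smul_of_tsupport {E : Type*} [NormedAddCommGroup E] [NormedSpace ℝ E]
    {𝕜 : Type*} [NormedField 𝕜] [NormedAlgebra ℝ 𝕜] [NormedSpace 𝕜 E] [IsScalarTower ℝ 𝕜 E]
    {n : WithTop ℕ∞} {χ : ℝ → 𝕜} {f : ℝ → E} (hχ : ContDiff ℝ n χ)
    (hf : ∀ t ∈ tsupport χ, ContDiffAt ℝ n f t) : ContDiff ℝ n fun t => χ t • f t := by
  rw [contDiff_iff_contDiffAt]
  intro t
  by_cases ht : t ∈ tsupport χ
  · exact hχ.contDiffAt.smul (hf t ht)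
  · refine (contDiffAt_const (c := (0 : E))).congr_of_eventuallyEq ?_
    filter_upwards [notMem_tsupport_iff_eventuallyEq.1 ht] with s hs
    rw [hs]
    simp

/-- Here `√(n² + δ²) ≤ n + δ` and `(n - δ)(n + δ) ≤ n²`. This measures the loss from smoothing the
phase `conj k / |k|`. -/
theorem sub_le_sq_div_sqrt {n δ : ℝ} (hn : 0 ≤ n) (hδ : 0 < δ) :
    n - δ ≤ (Real.sqrt (n ^ 2 + δ ^ 2))⁻¹ * n ^ 2 := by
  have h0 : 0 < Real.sqrt (n ^ 2 + δ ^ 2) := Real.sqrt_pos.2 (by positivity)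
  have h1 : Real.sqrt (n ^ 2 + δ ^ 2) ≤ n + δ :=
    Real.sqrt_le_iff.2 ⟨by positivity, by nlinarith [mul_nonneg hn hδ.le]⟩
  rw [inv_mul_eq_div, le_div_iff₀ h0]
  rcases le_total n δ with h | h
  · exact (mul_nonpos_of_nonpos_of_nonneg (by linarith) h0.le).trans (sq_nonneg n)
  · nlinarith [mul_le_mul_of_nonneg_left h1 (sub_nonneg.2 h), sq_nonneg δ]

/-- A smooth function that is bounded by `c` as a functional on test functions of sup-norm at most
one has `L¹`-norm at most `c` on compact intervals. -/
theorem integral_norm_le_of_forall_testFunction {k : ℝ → ℂ} {c a b : ℝ}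
    (hk : ∀ t, 0 < t → ContDiffAt ℝ ∞ k t) (ha : 0 < a) (hab : a < b)
    (h : ∀ φ : ℝ → ℂ, ContDiff ℝ ∞ φ → HasCompactSupport φ → tsupport φ ⊆ Ioo 0 (b + 1) →
      (∀ t, ‖φ t‖ ≤ 1) → ‖∫ t in (0 : ℝ)..(b + 1), φ t * k t‖ ≤ c) :
    ∫ t in a..b, ‖k t‖ ≤ c := by
  have hkc : ContinuousOn k (Icc a b) := fun t ht =>
    (hk t (ha.trans_le ht.1)).continuousAt.continuousWithinAt
  have hki : IntervalIntegrable (fun t => ‖k t‖) volume a b := by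
    refine ContinuousOn.intervalIntegrable ?_
    rw [uIcc_of_le hab.le]
    exact hkc.norm
  -- The cutoff equals `1` on `[a, b]`; the margin `min (a/2) (1/2)` keeps its support inside `(0, b
  -- + 1)`.
  let χ : ContDiffBump ((a + b) / 2) :=
    ⟨(b - a) / 2, (b - a) / 2 + min (a / 2) (1 / 2), by linarith, by
      have : 0 < min (a / 2) (1 / 2) := lt_min (by linarith) (by norm_num)
      linarith⟩
  have hχr : χ.rOut ≤ (b - a) / 2 + a / 2 ∧ χ.rOut ≤ (b - a) / 2 + 1 / 2 :=
    ⟨add_le_add_right (min_le_left _ _) _, add_le_add_right (min_le_right _ _) _⟩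
  have hχs : tsupport χ ⊆ Ioo 0 (b + 1) := by
    rw [χ.tsupport_eq]
    intro t ht
    rw [Real.closedBall_eq_Icc] at ht
    exact ⟨by linarith [ht.1, hχr.1], by linarith [ht.2, hχr.2]⟩
  have hχ1 : ∀ t ∈ Icc a b, χ t = 1 := fun t ht => by
    refine χ.one_of_mem_closedBall ?_
    rw [Real.closedBall_eq_Icc]
    exact ⟨by change (a + b) / 2 - (b - a) / 2 ≤ t; linarith [ht.1],
      by change t ≤ (a + b) / 2 + (b - a) / 2; linarith [ht.2]⟩
  have key : ∀ δ : ℝ, 0 < δ → ∫ t in a..b, (‖k t‖ - δ) ≤ c := by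
    intro δ hδ
    set q : ℝ → ℝ := fun t => (Real.sqrt (‖k t‖ ^ 2 + δ ^ 2))⁻¹ with hq
    have hq0 : ∀ t, 0 < Real.sqrt (‖k t‖ ^ 2 + δ ^ 2) := fun t => Real.sqrt_pos.2 (by positivity)
    have hqs : ∀ t, 0 < t → ContDiffAt ℝ ∞ q t := fun t ht =>
      ((((hk t ht).norm_sq ℝ).add contDiffAt_const).sqrt (by positivity)).inv (hq0 t).ne'
    -- The phase `conj k / |k|` is not smooth at zeros of `k`. Replacing `|k|` by `√(|k|² + δ²)`
    -- restores smoothness and keeps `|φ| ≤ 1`.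
    set φ : ℝ → ℂ := fun t => χ t • (q t • (starRingEnd ℂ) (k t)) with hφ
    have hφs : ContDiff ℝ ∞ φ := contDiff_smul_of_tsupport χ.contDiff fun t ht =>
      (hqs t (hχs ht).1).smul
        (Complex.conjCLE.contDiff.contDiffAt.comp t (hk t (hχs ht).1))
    have hφt : tsupport φ ⊆ tsupport χ := closure_mono fun t ht => by
      rw [Function.mem_support] at ht ⊢
      intro h0
      exact ht (by simp [hφ, h0])
    have hφ1 : ∀ t, ‖φ t‖ ≤ 1 := by
      intro t
      have h1 : ‖k t‖ ≤ Real.sqrt (‖k t‖ ^ 2 + δ ^ 2) :=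
        Real.le_sqrt_of_sq_le (by nlinarith [sq_nonneg δ])
      rw [hφ]
      simp only [norm_smul, RCLike.norm_conj, Real.norm_eq_abs, abs_of_nonneg χ.nonneg]
      rw [abs_of_pos (inv_pos.2 (hq0 t))]
      refine mul_le_one₀ χ.le_one (by positivity) ?_
      rw [inv_mul_eq_div]
      exact div_le_one_of_le₀ h1 (hq0 t).le
    set g : ℝ → ℝ := fun t => χ t • (q t * ‖k t‖ ^ 2) with hg
    have hgc : Continuous g := (contDiff_smul_of_tsupport (n := ∞) χ.contDiff fun t ht =>
      (hqs t (hχs ht).1).mul ((hk t (hχs ht).1).norm_sq ℝ)).continuous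
    have hg0 : ∀ t, 0 ≤ g t := fun t =>
      mul_nonneg χ.nonneg (mul_nonneg (inv_pos.2 (hq0 t)).le (sq_nonneg _))
    have hgφ : ∀ t, φ t * k t = (g t : ℂ) := by
      intro t
      simp only [hφ, hg, Complex.real_smul, smul_eq_mul]
      rw [mul_assoc, mul_assoc, Complex.conj_mul']
      push_cast
      ring
    have h2 := h φ hφs (χ.hasCompactSupport.mono' (subset_closure.trans hφt))
      (hφt.trans hχs) hφ1
    simp only [hgφ] at h2
    rw [intervalIntegral.integral_ofReal, Complex.norm_real] at h2
    calc ∫ t in a..b, (‖k t‖ - δ) ≤ ∫ t in a..b, g t := by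
          refine intervalIntegral.integral_mono_on hab.le (hki.sub intervalIntegrable_const)
            (hgc.intervalIntegrable _ _) fun t ht => ?_
          simp only [hg, hχ1 t ht, one_smul]
          exact sub_le_sq_div_sqrt (norm_nonneg _) hδ
      _ ≤ ∫ t in (0 : ℝ)..(b + 1), g t :=
          intervalIntegral.integral_mono_interval ha.le hab.le (by linarith)
            (Eventually.of_forall hg0) (hgc.intervalIntegrable _ _)
      _ ≤ c := (le_abs_self _).trans h2
  refine le_of_forall_pos_le_add fun ε hε => ?_
  have h3 := key (ε / (b - a)) (div_pos hε (sub_pos.2 hab))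
  rw [intervalIntegral.integral_sub hki intervalIntegrable_const,
    intervalIntegral.integral_const, smul_eq_mul, mul_div_cancel₀ _ (sub_pos.2 hab).ne'] at h3
  linarith

theorem integrableOn_Ioi_of_integral_norm_le {E : Type*} [NormedAddCommGroup E] {k : ℝ → E} {c : ℝ}
    (hk : ContinuousOn k (Ioi 0))
    (h : ∀ a b : ℝ, 0 < a → a < b → ∫ t in a..b, ‖k t‖ ≤ c) : IntegrableOn k (Ioi 0) := by
  have ha : Tendsto (fun n : ℕ => 1 / ((n : ℝ) + 1)) atTop (𝓝 0) :=
    tendsto_one_div_add_atTop_nhds_zero_nat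
  -- The offset `2` makes the interval `(1/(n+1), n+2]` nondegenerate already for `n = 0`.
  have hb : Tendsto (fun n : ℕ => (n : ℝ) + 2) atTop atTop :=
    tendsto_atTop_add_const_right _ _ tendsto_natCast_atTop_atTop
  have hab : ∀ n : ℕ, 1 / ((n : ℝ) + 1) < (n : ℝ) + 2 := fun n =>
    lt_of_le_of_lt ((div_le_one (by positivity)).2 (by linarith [n.cast_nonneg (α := ℝ)]))
      (by linarith [n.cast_nonneg (α := ℝ)] : (1 : ℝ) < n + 2)
  have hcov := (aecover_Ioi_of_Ioi (μ := volume) ha).inter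
    ((aecover_Iic (μ := volume) hb).restrict (s := Ioi 0))
  have hsub : ∀ n : ℕ, Icc (1 / ((n : ℝ) + 1)) (n + 2) ⊆ Ioi 0 := fun n t ht =>
    lt_of_lt_of_le (by positivity) ht.1
  have hset : ∀ n : ℕ, Ioi (1 / ((n : ℝ) + 1)) ∩ Iic ((n : ℝ) + 2) ∩ Ioi 0
      = Ioc (1 / ((n : ℝ) + 1)) (n + 2) := fun n => by
    rw [Ioi_inter_Iic]
    exact inter_eq_left.2 (Ioc_subset_Icc_self.trans (hsub n))
  refine hcov.integrable_of_integral_norm_bounded c (fun n => ?_) (Eventually.of_forall fun n => ?_)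
  · rw [IntegrableOn, Measure.restrict_restrict (measurableSet_Ioi.inter measurableSet_Iic), hset]
    exact ((hk.mono (hsub n)).integrableOn_Icc).mono_set Ioc_subset_Icc_self
  · rw [Measure.restrict_restrict (measurableSet_Ioi.inter measurableSet_Iic), hset,
      ← intervalIntegral.integral_of_le (hab n).le]
    exact h _ _ (by positivity) (hab n)

/-! ### Classical solutions of a system node. -/

theorem C0Semigroup.generatorExt_resolventExt {X : Type*} [NormedAddCommGroup X] [NormedSpace ℂ X]
    [CompleteSpace X] {T : C0Semigroup X} {β : T.resolventSet} (z : T.Xm1 β) :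
    T.generatorExt β (resolventExt β β.2 z)
      = T.ι β ((β : ℂ) • resolventExt β β.2 z) - z := by
  refine (T.denseRange_ι β).induction_on z (isClosed_eq (by fun_prop) (by fun_prop)) fun x => ?_
  rw [resolventExt_ι, ← map_sub]
  have h := shift_resolvent β.2 x
  rw [shift_apply] at h
  rw [T.generatorExt_apply β ⟨_, resolvent_mem β.2 x⟩]
  congr 1
  rw [sub_eq_iff_eq_add] at h
  exact eq_sub_iff_add_eq'.2 h.symm

namespace SystemNode

open C0Semigroup

variable {U X Y : Type*} [NormedAddCommGroup U] [NormedSpace ℂ U]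
  [NormedAddCommGroup X] [NormedSpace ℂ X] [CompleteSpace X]
  [NormedAddCommGroup Y] [NormedSpace ℂ Y] (N : SystemNode U X Y)

/-- `R(β, A₋₁) B`. -/
noncomputable def inputResolvent : U →L[ℂ] X := (resolventExt N.β N.β.2).comp N.B

variable {N}

/-- The change in `R(γ, A) B u` is compensated by the change in `G(γ) u`. It suffices to verify the
output equation at a single `γ`. -/
theorem CD_eq_CD {p : X × U} (hp : p ∈ N.domCD) {γ γ' : ℂ} (hγ : γ ∈ N.T.halfPlane)
    (hγ' : γ' ∈ N.T.halfPlane) : N.CD hp hγ = N.CD hp hγ' := by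
  have h := N.G_sub γ γ' hγ hγ' p.2
  rw [sub_eq_iff_eq_add] at h
  rw [CD, CD, h, ← add_assoc, ← map_add]
  congr 2
  refine X1.ext ?_
  change p.1 - resolventExt N.β _ (N.B p.2) + (resolventExt N.β _ (N.B p.2)
    - resolventExt N.β _ (N.B p.2)) = p.1 - resolventExt N.β _ (N.B p.2)
  abel

theorem IsClassicalSolution.output_eq_of_input_eq_zero {u : ℝ → U} {x : ℝ → X} {y : ℝ → Y}
    (h : N.IsClassicalSolution u x y) {t : ℝ} (ht : 0 ≤ t) (hu : u t = 0) {z : X}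
    (hz : N.T.resolvent N.β.2 z = x t) : y t = N.C (X1.ofResolvent N.T N.β z) := by
  obtain ⟨γ, hγ⟩ := N.T.halfPlane_nonempty
  rw [h.output_eq t ht γ hγ, CD]
  simp only [hu, map_zero, add_zero]
  congr 1
  refine X1.mk_eq_ofResolvent _ ?_
  rw [hz, sub_zero]

/-- For a smooth input that vanishes near `(-∞, 0]` there is a classical solution with initial
state zero. -/
theorem exists_isClassicalSolution {u : ℝ → U} (hu : ContDiff ℝ ∞ u) (hu0 : tsupport u ⊆ Ioi 0) :
    ∃ y : ℝ → Y, N.IsClassicalSolution u (fun t => N.inputResolvent (u t)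
      + N.T.duhamel (fun s => (N.β : ℂ) • N.inputResolvent (u s)
        - N.inputResolvent (deriv u s)) t) y := by
  obtain ⟨γ, hγ⟩ := N.T.halfPlane_nonempty
  have hz : ∀ w : ℝ → U, tsupport w ⊆ Ioi 0 → ∀ t ≤ 0, w t = 0 := fun w hw t ht =>
    image_eq_zero_of_notMem_tsupport fun h => not_lt_of_ge ht (hw h)
  have hu1s : ContDiff ℝ ∞ (deriv u) := (contDiff_infty_iff_deriv.1 hu).2
  have hu2s : ContDiff ℝ ∞ (deriv (deriv u)) := (contDiff_infty_iff_deriv.1 hu1s).2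
  have hd : ∀ t, HasDerivAt u (deriv u t) t := fun t =>
    (hu.differentiable (by simp) t).hasDerivAt
  have hd1 : ∀ t, HasDerivAt (deriv u) (deriv (deriv u) t) t := fun t =>
    (hu1s.differentiable (by simp) t).hasDerivAt
  have h0 := hz u hu0
  have h1 := hz _ ((tsupport_deriv_subset (𝕜 := ℝ) (f := u)).trans hu0)
  have h2 := hz _ ((tsupport_deriv_subset (𝕜 := ℝ) (f := deriv u)).trans
    ((tsupport_deriv_subset (𝕜 := ℝ) (f := u)).trans hu0))
  have c0 := hu.continuous
  have c1 := hu1s.continuous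
  have c2 := hu2s.continuous
  set r := N.inputResolvent with hr
  have hrd : ∀ t, HasDerivAt (fun t => r (u t)) (r (deriv u t)) t := fun t =>
    (r.restrictScalars ℝ).hasFDerivAt.comp_hasDerivAt t (hd t)
  have hrd1 : ∀ t, HasDerivAt (fun t => r (deriv u t)) (r (deriv (deriv u) t)) t := fun t =>
    (r.restrictScalars ℝ).hasFDerivAt.comp_hasDerivAt t (hd1 t)
  -- Since `B u = (β - A₋₁) r u`, the difference `w = x - r u` solves `w' = A w + g`, whose forcing
  -- term takes values in `X` rather than `X₋₁`.
  set g : ℝ → X := fun s => (N.β : ℂ) • r (u s) - r (deriv u s) with hg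
  set g' : ℝ → X := fun s => (N.β : ℂ) • r (deriv u s) - r (deriv (deriv u) s) with hg'
  have hgd : ∀ t, HasDerivAt g (g' t) t := fun t => ((hrd t).const_smul (N.β : ℂ)).sub (hrd1 t)
  have hgc : Continuous g := by fun_prop
  have hgc' : Continuous g' := by fun_prop
  have hg0 : ∀ t ≤ 0, g t = 0 := fun t ht => by simp [hg, h0 t ht, h1 t ht]
  have hg0' : ∀ t ≤ 0, g' t = 0 := fun t ht => by simp [hg', h1 t ht, h2 t ht]
  have hx : ∀ t, HasDerivAt (fun t => r (u t) + N.T.duhamel g t)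
      (r (deriv u t) + N.T.duhamel g' t) t := fun t =>
    (hrd t).add (hasDerivAt_duhamel hgd hgc' hg0 hg0' t)
  have hdg := continuous_duhamel (T := N.T) hgc
  have hdg' := continuous_duhamel (T := N.T) hgc'
  have hdg2 : Continuous (N.T.duhamel fun s => (N.β : ℂ) • g s - g' s) :=
    continuous_duhamel (by fun_prop)
  have hstate : ∀ t, 0 ≤ t → N.T.ι N.β (r (deriv u t) + N.T.duhamel g' t)
      = N.T.generatorExt N.β (r (u t) + N.T.duhamel g t) + N.B (u t) := by
    intro t ht
    obtain ⟨k1, k2⟩ := (N.T.generator_eq_iff _ _).2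
      (tendsto_duhamel_slope (T := N.T) hgd hgc' hg0 hg0' ht)
    have k3 := N.T.generatorExt_apply N.β ⟨_, k1⟩
    rw [k2] at k3
    simp only at k3
    have k4 : N.T.generatorExt N.β (r (u t)) = N.T.ι N.β ((N.β : ℂ) • r (u t)) - N.B (u t) :=
      generatorExt_resolventExt (N.B (u t))
    rw [map_add (N.T.generatorExt N.β), k3, k4, sub_add_eq_add_sub, sub_add_cancel, ← map_add]
    congr 1
    simp only [hg]
    abel
  have hmem : ∀ t, 0 ≤ t → ((fun t => r (u t) + N.T.duhamel g t) t, u t) ∈ N.domCD :=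
    fun t ht => ⟨_, hstate t ht⟩
  -- The argument of `C` is `x - R(γ, A) B u` written as `R(β, A)` of a continuous `X`-valued
  -- function, which makes continuity of the output immediate. The term with `β - γ` comes from the
  -- resolvent identity, as `β` need not lie in the half-plane.
  refine ⟨fun t => N.C (X1.ofResolvent N.T N.β
    ((N.T.duhamel (fun s => (N.β : ℂ) • g s - g' s) t + g t)
      - ((N.β : ℂ) - γ) • resolventExt N.β (N.T.halfPlane_subset hγ) (N.B (u t))))
      + N.G γ (u t), c0.continuousOn, ?_, ?_, hmem, ?_, ?_⟩
  · refine ContDiff.contDiffOn (contDiff_one_iff_deriv.2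
      ⟨fun t => (hx t).differentiableAt, ?_⟩)
    rw [show deriv (fun t => r (u t) + N.T.duhamel g t) = _ from funext fun t => (hx t).deriv]
    fun_prop
  · exact Continuous.continuousOn (by fun_prop)
  · intro t ht
    rw [(hx t).hasDerivWithinAt.derivWithin (uniqueDiffOn_Ici 0 t ht)]
    exact hstate t ht
  · intro t ht γ' hγ'
    rw [CD_eq_CD (hmem t ht) hγ' hγ, CD]
    congr 2
    refine (X1.mk_eq_ofResolvent _ ?_).symm
    rw [map_sub, resolvent_duhamel N.β.2 hgd hgc' hg0 hg0' ht, map_smul]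
    have k := resolventExt_sub N.β N.β.2 (N.T.halfPlane_subset hγ) (N.B (u t))
    have k' : ((N.β : ℂ) - γ) • N.T.resolvent N.β.2
        (resolventExt N.β (N.T.halfPlane_subset hγ) (N.B (u t)))
        = resolventExt N.β (N.T.halfPlane_subset hγ) (N.B (u t)) - r (u t) := by
      rw [← neg_sub γ, neg_smul, ← k, neg_sub]
      rfl
    rw [k']
    change _ = r (u t) + N.T.duhamel g t - _
    abel

end SystemNode

/-! ### The output as a convolution with the impulse response. -/

namespace SystemNode

open C0Semigroup

variable {U X Y : Type*} [NormedAddCommGroup U] [NormedSpace ℂ U]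
  [NormedAddCommGroup X] [NormedSpace ℂ X] [CompleteSpace X]
  [NormedAddCommGroup Y] [NormedSpace ℂ Y] (N : SystemNode U X Y)

/-- The operator `T₋₁(t) B : U → X₁`, for `t > 0`. -/
noncomputable def smoothedInput (S : ℂ → X →L[ℂ] X) (t : ℝ) : U →L[ℂ] N.T.X1 N.β :=
  (X1.ofResolvent N.T N.β).comp ((smoothing S N.β t).comp N.inputResolvent)

variable {N} {θ : ℝ} {S : ℂ → X →L[ℂ] X}

theorem contDiffAt_smoothedInput (hθ : 0 < θ) (hS : AnalyticOnNhd ℂ S (sector θ)) {t : ℝ}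
    (ht : 0 < t) (ℓ : Y →L[ℂ] ℂ) (u : U) :
    ContDiffAt ℝ ∞ (fun t => ℓ (N.C (N.smoothedInput S t u))) t := by
  let L : (X →L[ℂ] X) →L[ℂ] ℂ := (ℓ.comp (N.C.comp (X1.ofResolvent N.T N.β))).comp
    (ContinuousLinearMap.apply ℂ X (N.inputResolvent u))
  exact (L.restrictScalars ℝ).contDiff.contDiffAt.comp t (contDiffAt_smoothing hθ hS ht)

/-- Away from the support of the input, the output is the convolution of the input with the
impulse response. -/
theorem exists_output_eq_integral (hθ : 0 < θ) (hS : AnalyticOnNhd ℂ S (sector θ))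
    (hST : ∀ t : ℝ≥0, 0 < t → S ((t : ℝ) : ℂ) = N.T.op t) {φ : ℝ → ℂ} {τ : ℝ}
    (hφ : ContDiff ℝ ∞ φ) (hφτ : tsupport φ ⊆ Ioo 0 τ) (hτ : 0 ≤ τ) (u₀ : U) :
    ∃ (x : ℝ → X) (y : ℝ → Y), N.IsClassicalSolution (fun t => φ (τ - t) • u₀) x y ∧ x 0 = 0 ∧
      ∀ ℓ : Y →L[ℂ] ℂ, ℓ (y τ)
        = ∫ t in (0 : ℝ)..τ, φ t * ℓ (N.C (N.smoothedInput S t u₀)) := by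
  set u : ℝ → U := fun t => φ (τ - t) • u₀ with hu
  have hus : ContDiff ℝ ∞ u := (hφ.comp (contDiff_const.sub contDiff_id)).smul contDiff_const
  have hφ0 : ∀ t, t ∉ Ioo 0 τ → φ t = 0 := fun t ht =>
    image_eq_zero_of_notMem_tsupport fun h => ht (hφτ h)
  have hut : tsupport u ⊆ Ioi 0 := by
    have h1 : tsupport u ⊆ (fun t => τ - t) ⁻¹' tsupport φ :=
      closure_minimal (fun t ht => subset_closure fun h0 => ht (by simp [hu, h0]))
        ((isClosed_tsupport φ).preimage (by fun_prop))
    intro t ht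
    have := (hφτ (h1 ht)).2
    simp only [mem_Ioi]
    linarith
  have hu0 : ∀ t ≤ 0, u t = 0 := fun t ht =>
    image_eq_zero_of_notMem_tsupport fun h => not_lt_of_ge ht (hut h)
  have hu0' : ∀ t ≤ 0, deriv u t = 0 := fun t ht =>
    image_eq_zero_of_notMem_tsupport fun h =>
      not_lt_of_ge ht (hut (tsupport_deriv_subset (𝕜 := ℝ) (f := u) h))
  have huτ : u τ = 0 := by simp [hu, hφ0 0 (by simp)]
  obtain ⟨y, hy⟩ := exists_isClassicalSolution (N := N) hus hut
  have hus' : ContDiff ℝ ∞ (deriv u) := (contDiff_infty_iff_deriv.1 hus).2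
  have hrd : ∀ t, HasDerivAt (fun t => N.inputResolvent (u t)) (N.inputResolvent (deriv u t)) t :=
    fun t => (N.inputResolvent.restrictScalars ℝ).hasFDerivAt.comp_hasDerivAt t
      (hus.differentiable (by simp) t).hasDerivAt
  have hsm : ContDiff ℝ ∞ fun t => φ t • smoothing S N.β t (N.inputResolvent u₀) :=
    contDiff_smul_of_tsupport hφ fun t ht =>
      (((ContinuousLinearMap.apply ℂ X (N.inputResolvent u₀)).restrictScalars
        ℝ).contDiff.contDiffAt).comp t (contDiffAt_smoothing hθ hS (hφτ ht).1)
  have hsi : IntervalIntegrable (fun t => φ t • smoothing S N.β t (N.inputResolvent u₀)) volume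
    0 τ := hsm.continuous.intervalIntegrable _ _
  -- This is the candidate for `(β - A) x(τ)`. The integral is harmless at `0` because `φ` vanishes
  -- near `0`.
  set z : X := ∫ t in (0 : ℝ)..τ, φ t • smoothing S N.β t (N.inputResolvent u₀) with hz
  have hzz : N.T.resolvent N.β.2 (N.T.resolvent N.β.2 z)
      = N.T.duhamel (fun t => N.inputResolvent (u t)) τ := by
    rw [hz, ← ContinuousLinearMap.comp_apply,
      ← ContinuousLinearMap.intervalIntegral_comp_comm _ hsi, duhamel]
    refine intervalIntegral.integral_congr fun t ht => ?_
    simp only [map_smul, hu, sub_sub_cancel]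
    by_cases h : t ∈ Ioo 0 τ
    · rw [ContinuousLinearMap.comp_apply, resolvent_resolvent_smoothing hθ hS hST h.1]
    · rw [hφ0 t h, zero_smul, zero_smul]
  have hzx : N.T.resolvent N.β.2 z = N.inputResolvent (u τ)
      + N.T.duhamel (fun s => (N.β : ℂ) • N.inputResolvent (u s)
        - N.inputResolvent (deriv u s)) τ := by
    -- After one more resolvent, both sides equal the convolution of `T` with `r u`: the left by
    -- `hzz`, the right by `resolvent_duhamel` with `f = r u`.
    refine resolvent_injective N.β.2 ?_
    rw [hzz, add_comm, resolvent_duhamel N.β.2 hrd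
      (N.inputResolvent.continuous.comp hus'.continuous) (fun t ht => by rw [hu0 t ht, map_zero])
      (fun t ht => by rw [hu0' t ht, map_zero]) hτ]
  refine ⟨_, y, hy, ?_, fun ℓ => ?_⟩
  · simp only [hu0 0 le_rfl, map_zero, duhamel_zero, add_zero]
  · rw [hy.output_eq_of_input_eq_zero hτ huτ hzx]
    let L : X →L[ℂ] ℂ := ℓ.comp (N.C.comp (X1.ofResolvent N.T N.β))
    change L z = _
    rw [hz, ← L.intervalIntegral_comp_comm hsi]
    refine intervalIntegral.integral_congr fun t _ => ?_
    simp only [map_smul, smul_eq_mul]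
    rfl

/-- Entries of the impulse response of a `C^∞`-BIBO stable node are integrable. -/
theorem integrableOn_impulseResponse (hN : N.IsSmoothBIBOStable) (hθ : 0 < θ)
    (hS : AnalyticOnNhd ℂ S (sector θ))
    (hST : ∀ t : ℝ≥0, 0 < t → S ((t : ℝ) : ℂ) = N.T.op t) (ℓ : Y →L[ℂ] ℂ) (u₀ : U) :
    IntegrableOn (fun t => ℓ (N.C (N.smoothedInput S t u₀))) (Ioi 0) := by
  obtain ⟨c, hc, h⟩ := hN
  have hk := fun t (ht : 0 < t) => contDiffAt_smoothedInput (N := N) hθ hS ht ℓ u₀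
  refine integrableOn_Ioi_of_integral_norm_le (c := ‖ℓ‖ * (c * ‖u₀‖))
    (fun t ht => (hk t ht).continuousAt.continuousWithinAt) fun a b ha hab => ?_
  refine integral_norm_le_of_forall_testFunction hk ha hab fun φ hφ hφc hφs hφ1 => ?_
  have hτ : 0 ≤ b + 1 := by linarith
  obtain ⟨x, y, hxy, hx0, hy⟩ := exists_output_eq_integral (N := N) hθ hS hST hφ hφs hτ u₀
  have h1 : tsupport (fun t => φ (b + 1 - t) • u₀) ⊆ (fun t => b + 1 - t) ⁻¹' tsupport φ :=
    closure_minimal (fun t ht => subset_closure fun h0 => ht (by simp only [h0, zero_smul]))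
      ((isClosed_tsupport φ).preimage (by fun_prop))
  -- Time reversal preserves `(0, b + 1)`, so the input is admissible in the stability estimate.
  have h2 : tsupport (fun t => φ (b + 1 - t) • u₀) ⊆ Ioo 0 (b + 1) := fun t ht => by
    have := hφs (h1 ht)
    exact ⟨by linarith [this.2], by linarith [this.1]⟩
  obtain ⟨hb, hle⟩ := h _ x y hxy hx0
    ((hφ.comp (contDiff_const.sub contDiff_id)).smul contDiff_const)
    (isCompact_Icc.of_isClosed_subset (isClosed_tsupport _) (h2.trans Ioo_subset_Icc_self))
    (h2.trans Ioo_subset_Ioi_self)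
  rw [← hy ℓ]
  refine (ℓ.le_opNorm _).trans ?_
  gcongr
  calc ‖y (b + 1)‖ ≤ ⨆ t : Ici (0 : ℝ), ‖y t‖ := le_ciSup hb ⟨b + 1, hτ⟩
    _ ≤ c * ⨆ t : Ici (0 : ℝ), ‖φ (b + 1 - t) • u₀‖ := hle
    _ ≤ c * ‖u₀‖ := by
      gcongr
      refine Real.iSup_le (fun t => ?_) (norm_nonneg _)
      rw [norm_smul]
      exact mul_le_of_le_one_left (norm_nonneg _) (hφ1 _)

end SystemNode

/-! ### From scalar entries to operators in finite dimensions. -/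

theorem clm_eq_sum_entries {ι κ U Y : Type*} [Fintype ι] [Fintype κ]
    [NormedAddCommGroup U] [NormedSpace ℂ U] [FiniteDimensional ℂ U]
    [NormedAddCommGroup Y] [NormedSpace ℂ Y] [FiniteDimensional ℂ Y]
    (e : Module.Basis ι ℂ U) (f : Module.Basis κ ℂ Y) (K : U →L[ℂ] Y) :
    K = ∑ j, ∑ i, LinearMap.toContinuousLinearMap (f.coord i) (K (e j)) •
      (LinearMap.toContinuousLinearMap (e.coord j)).smulRight (f i) := by
  ext u
  simp only [sum_apply, smul_apply, ContinuousLinearMap.smulRight_apply]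
  have h1 : ∀ j, ∑ i, LinearMap.toContinuousLinearMap (f.coord i) (K (e j)) •
      LinearMap.toContinuousLinearMap (e.coord j) u • f i = e.repr u j • K (e j) := fun j => by
    nth_rewrite 2 [← f.sum_repr (K (e j))]
    rw [Finset.smul_sum]
    exact Finset.sum_congr rfl fun i _ => smul_comm _ _ _
  simp only [h1]
  nth_rewrite 1 [← e.sum_repr u]
  rw [map_sum]
  exact Finset.sum_congr rfl fun j _ => map_smul _ _ _

/-- An operator-valued function between finite-dimensional spaces is integrable if its matrix
entries are. -/
theorem integrable_clm_of_forall_entry {α U Y : Type*} [MeasurableSpace α] {μ : Measure α}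
    [NormedAddCommGroup U] [NormedSpace ℂ U] [FiniteDimensional ℂ U]
    [NormedAddCommGroup Y] [NormedSpace ℂ Y] [FiniteDimensional ℂ Y] {K : α → U →L[ℂ] Y}
    (h : ∀ (ℓ : Y →L[ℂ] ℂ) (u : U), Integrable (fun t => ℓ (K t u)) μ) :
    Integrable K μ := by
  rw [funext fun t => clm_eq_sum_entries (Module.finBasis ℂ U) (Module.finBasis ℂ Y) (K t)]
  have hij : ∀ (ℓ : Y →L[ℂ] ℂ) (u : U) (A : U →L[ℂ] Y), Integrable (fun t => ℓ (K t u) • A) μ :=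
    fun ℓ u A => (h ℓ u).smul_const A
  exact integrable_finsetSum (ε' := U →L[ℂ] Y) _ fun j _ =>
    integrable_finsetSum (ε' := U →L[ℂ] Y) _ fun i _ => hij _ _ _

/-- For an analytic semigroup and finite-dimensional input and output spaces, `C^∞`-BIBO stability
implies that `T₋₁(t) B` is a bounded operator `V t : U → X₁` for every `t > 0`, and that
`t ↦ C T₋₁(t) B` is integrable on `[0, ∞)` with values in the bounded operators `U → Y`. -/
theorem mainTheorem10 {U X Y : Type*} [NormedAddCommGroup U] [NormedSpace ℂ U]
    [FiniteDimensional ℂ U] [NormedAddCommGroup X] [NormedSpace ℂ X] [CompleteSpace X]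
    [NormedAddCommGroup Y] [NormedSpace ℂ Y] [FiniteDimensional ℂ Y]
    (N : SystemNode U X Y) (hA : N.T.IsAnalyticSemigroup) (hN : N.IsSmoothBIBOStable) :
    ∃ V : ℝ≥0 → U →L[ℂ] N.T.X1 N.β,
      (∀ t, 0 < t → ∀ u : U, N.T.ι N.β (V t u).val = N.T.opExt N.β t (N.B u)) ∧
      IntegrableOn (fun t : ℝ => N.C.comp (V t.toNNReal)) (Ioi 0) := by
  obtain ⟨θ, hθ, -, S, hS, -, hST⟩ := hA
  -- The value at `t = 0` carries no meaning; both claims concern `t > 0` only.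
  refine ⟨fun t => N.smoothedInput S t,
    fun t ht u => C0Semigroup.ι_ofResolvent_smoothing hθ hS hST ht (N.B u), ?_⟩
  refine integrable_clm_of_forall_entry fun ℓ u => ?_
  refine (SystemNode.integrableOn_impulseResponse hN hθ hS hST ℓ u).congr_fun (fun t ht => ?_)
    measurableSet_Ioi
  simp only [ContinuousLinearMap.comp_apply]
  rw [Real.coe_toNNReal t (le_of_lt ht)]
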